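/- Theorem (Normal form for stabilizer circuits). Let $n\ge 0$ and write basis states of $n$ qubits as $|x\rangle$, $x\in\mathbb F_2^n$. Let $P=\mathrm{diag}(1,i)$, $H=\frac1{\sqrt2}\begin{pmatrix}1&1\\1&-1\end{pmatrix}$, and let $X$, $Z$ be the Pauli gates. For a one-qubit gate $U$, let $U_i$ be $U$ applied to qubit $i$, and for $u\in\mathbb F_2^n$ let $U_u=\bigotimes_i U^{u_i}$ ($U$ on the qubits with $u_i=1$, the identity on the others). For $i\ne j$ let $X_{[ij]}$ be the CNOT gate with target $i$ and control $j$. For $A\in GL_n(\mathbb F_2)$ let $X_A|x\rangle=|Ax\rangle$ (an element of the group generated by the CNOT gates). For a symmetric matrix $B$ over $\mathbb F_2$ with zero diagonal (a CZ-set) let $Z_B|x\rangle=(-1)^{\sum_{i<j}B_{ij}x_ix_j}|x\rangle$ (a product of CZ gates). Let $\mathbf H=H^{\otimes n}$. Every stabilizer circuit $C=\prod_{k=1}^{\ell}M_k$, $\ell\ge 0$, with gates $M_k\in\{P_i,\,H_i,\,X_{[ij]}\}$, can be written exactly (including the global phase) as $$C=H_w\,P_b\,Z_B\,\mathbf H\,e^{i\phi}\,X_u\,Z_v\,P_d\,Z_D\,X_A,$$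 where $b,d,u,v,w\in\mathbb F_2^n$, $B,D$ are symmetric zero-diagonal matrices over $\mathbb F_2$, $A\in GL_n(\mathbb F_2)$ and $\phi\in\{k\frac\pi4 : k\in\mathbb Z\}$. Moreover, such a form is computable in time $O(\ell n^2)$: there are a single program and a constant $K$ such that for all $n$ and all circuits $C$ as above, the program, given $n$, $\ell$ and the list of gates, halts after at most $K\cdot\max(\ell,1)\cdot\max(n,1)^2$ steps (that is, at most $K\ell n^2$ if $\ell\ge1$) and outputs all entries of $w,b,u,v,d,B,D,A$ and an integer $k$ with $\phi=k\frac\pi4$. Here time is counted on a unit-cost random access machine with finitely many registers and finitely many two-dimensional arrays of natural numbers, whose only operations are constants, reading and writing of registers and array entries, increment, decrement, comparison, branching and while-loops. -/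

import Mathlib

open scoped Matrix

namespace Stab

/-! ### Operators on `n` qubits

The computational basis of the state space is indexed by the bit vectors `b : Fin n → ZMod 2`, and
an operator is given by its complex matrix in this basis. -/

/-- Bit vectors of length `n`, that is, the vectors of `𝔽₂ⁿ`. -/
abbrev BitVec₂ (n : ℕ) : Type := Fin n → ZMod 2

/-- Operators on `n` qubits. -/
abbrev Op (n : ℕ) : Type := Matrix (BitVec₂ n) (BitVec₂ n) ℂ

/-- Operators on one qubit. -/
abbrev Op₁ : Type := Matrix (ZMod 2) (ZMod 2) ℂ

noncomputable section

/-- The Pauli gate `X |a⟩ = |a ⊕ 1⟩`. -/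
def pauliX : Op₁ := Matrix.of fun a b => if a = b + 1 then 1 else 0

/-- The Pauli gate `Z |a⟩ = (-1)^a |a⟩`. -/
def pauliZ : Op₁ := Matrix.diagonal fun a => (-1) ^ a.val

/-- The phase gate `P |a⟩ = i^a |a⟩`. -/
def phaseGate : Op₁ := Matrix.diagonal fun a => Complex.I ^ a.val

/-- The Hadamard gate, with entries `(-1)^(ab) / √2`. -/
def hadamardGate : Op₁ := Matrix.of fun a b => (-1) ^ (a.val * b.val) / (Real.sqrt 2 : ℂ)

variable {n : ℕ}

/-- The Kronecker product `U₀ ⊗ U₁ ⊗ ⋯ ⊗ Uₙ₋₁`. -/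
def tensor (U : Fin n → Op₁) : Op n := Matrix.of fun a b => ∏ i, U i (a i) (b i)

/-- The operator `U_i` applying the one-qubit gate `U` to qubit `i`. -/
def onQubit (U : Op₁) (i : Fin n) : Op n := tensor fun j => if j = i then U else 1

/-- The operator `U_u` applying the one-qubit gate `U` to the qubits `i` with `u i = 1`. -/
def onQubits (U : Op₁) (u : BitVec₂ n) : Op n := tensor fun j => if u j = 1 then U else 1

/-- The Hadamard gate on all qubits. -/
def hadamardAll (n : ℕ) : Op n := tensor fun _ => hadamardGate

/-- The CNOT gate `X_{[ij]}` with target `i` and control `j`. -/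
def cnot (i j : Fin n) : Op n :=
  Matrix.of fun a b => if a = Function.update b i (b i + b j) then 1 else 0

/-- The operator `|b⟩ ↦ |M b⟩` for a matrix `M` over `𝔽₂`. -/
def linearOp (M : Matrix (Fin n) (Fin n) (ZMod 2)) : Op n :=
  Matrix.of fun a b => if a = M *ᵥ b then 1 else 0

/-- The operator `X_A` for `A ∈ GLₙ(𝔽₂)`, that is, the element of the group generated by the CNOT
gates which acts by `X_A |b⟩ = |A b⟩`; see `linearOp_transvection`, `linearOp_mul` and
`linearGate_mem`. -/
def linearGate (A : GL (Fin n) (ZMod 2)) : Op n := linearOp (A : Matrix (Fin n) (Fin n) (ZMod 2))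

theorem linearOp_transvection {i j : Fin n} :
    linearOp (Matrix.transvection i j (1 : ZMod 2)) = cnot i j := by
  ext a b
  have h : Matrix.transvection i j (1 : ZMod 2) *ᵥ b = Function.update b i (b i + b j) := by
    ext k
    rw [Matrix.transvection, Matrix.add_mulVec, Matrix.one_mulVec, Matrix.single_mulVec]
    by_cases hk : k = i
    · subst hk; simp
    · simp [hk]
  simp [linearOp, cnot, h]

theorem linearOp_mul (M N : Matrix (Fin n) (Fin n) (ZMod 2)) :
    linearOp (M * N) = linearOp M * linearOp N := by
  ext a b
  simp [linearOp, Matrix.mul_apply, Matrix.mulVec_mulVec]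

theorem linearOp_one : linearOp (1 : Matrix (Fin n) (Fin n) (ZMod 2)) = 1 := by
  ext a b
  simp [linearOp, Matrix.one_apply]

theorem linearGate_mem (A : GL (Fin n) (ZMod 2)) :
    linearGate A ∈ Submonoid.closure {U : Op n | ∃ i j, i ≠ j ∧ U = cnot i j} := by
  have hdet : (A : Matrix (Fin n) (Fin n) (ZMod 2)).det ≠ 0 :=
    ((Matrix.isUnit_iff_isUnit_det _).1 A.isUnit).ne_zero
  refine Matrix.diagonal_transvection_induction_of_det_ne_zero
    (fun M => linearOp M ∈ Submonoid.closure {U : Op n | ∃ i j, i ≠ j ∧ U = cnot i j}) _ hdet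
    ?_ ?_ ?_
  · intro D hD
    have hD1 : D = 1 := by
      funext i
      have h := (Finset.prod_ne_zero_iff.1 (by simpa [Matrix.det_diagonal] using hD)) i
        (Finset.mem_univ i)
      have key : ∀ x : ZMod 2, x ≠ 0 → x = 1 := by decide
      exact key _ h
    have h1 : Matrix.diagonal D = 1 := by rw [hD1]; exact Matrix.diagonal_one
    rw [h1, linearOp_one]
    exact one_mem _
  · rintro ⟨i, j, hij, c⟩
    have key : ∀ x : ZMod 2, x = 0 ∨ x = 1 := by decide
    rcases key c with rfl | rfl
    · simp [Matrix.TransvectionStruct.toMatrix, linearOp_one]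
    · refine Submonoid.subset_closure ⟨i, j, hij, ?_⟩
      exact linearOp_transvection
  · intro M N _ _ hM hN
    rw [linearOp_mul]
    exact mul_mem hM hN

/-- The matrix form of a set of pairs `{i, j}` of distinct qubits: a symmetric matrix over `𝔽₂`
with zero diagonal, whose entry `(i, j)` is `1` exactly when `{i, j}` is in the set. -/
def CZSet (n : ℕ) : Type :=
  {B : Matrix (Fin n) (Fin n) (ZMod 2) // B.IsSymm ∧ ∀ i, B i i = 0}

/-- The operator `Z_B`, the product of the CZ gates `Z_{ij} |x⟩ = (-1)^(x_i x_j) |x⟩` over all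
pairs `{i, j}` in `B`. -/
def czGate (B : CZSet n) : Op n :=
  Matrix.diagonal fun x =>
    ∏ p : Fin n × Fin n with p.1 < p.2 ∧ B.1 p.1 p.2 = 1, (-1) ^ ((x p.1).val * (x p.2).val)

/-! ### Stabilizer circuits and the normal form -/

/-- The gates of a stabilizer circuit on `n` qubits: `P_i`, `H_i`, and `X_{[ij]}` (target `i`,
control `j`). -/
inductive Gate (n : ℕ) : Type
  | P (i : Fin n) : Gate n
  | H (i : Fin n) : Gate n
  | CX (i j : Fin n) (hij : i ≠ j) : Gate n

/-- The operator of a gate. -/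
def Gate.op : Gate n → Op n
  | .P i => onQubit phaseGate i
  | .H i => onQubit hadamardGate i
  | .CX i j _ => cnot i j

/-- The operator of the circuit `∏ M_k`, as a product of matrices in the given order. -/
def circuitOp (C : List (Gate n)) : Op n := (C.map Gate.op).prod

/-- The data of a normal form; the phase is `φ = k π / 4`. -/
structure NormalForm (n : ℕ) where
  w : BitVec₂ n
  b : BitVec₂ n
  u : BitVec₂ n
  v : BitVec₂ n
  d : BitVec₂ n
  B : CZSet n
  D : CZSet n
  A : GL (Fin n) (ZMod 2)
  k : ℤ

/-- The phase angle `φ = k π / 4`. -/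
def NormalForm.angle (N : NormalForm n) : ℝ := N.k * (Real.pi / 4)

/-- The operator `H_w P_b Z_B 𝐇 e^{iφ} X_u Z_v P_d Z_D X_A`. -/
def NormalForm.op (N : NormalForm n) : Op n :=
  onQubits hadamardGate N.w * onQubits phaseGate N.b * czGate N.B * hadamardAll n *
    (Complex.exp (Complex.I * (N.angle : ℂ)) •
      (onQubits pauliX N.u * onQubits pauliZ N.v * onQubits phaseGate N.d * czGate N.D *
        linearGate N.A))

end

/-! ### A random access machine

Programs are finite pieces of syntax. They work on finitely many registers and on finitely many
two-dimensional arrays of natural numbers; register and array names are fixed in the program text,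
array indices are computed. The arithmetic is restricted to increments, decrements and comparisons,
so that the numbers occurring in a run exceed the largest number in the input and in the program
text by at most the running time, and all operations are on short words. Every elementary operation
(evaluation of a node of an expression, an assignment, a branching) costs one step. -/

/-- A machine state: the contents of the registers and of the arrays. -/
structure State where
  reg : ℕ → ℕ
  mem : ℕ → ℕ → ℕ → ℕ

/-- Expressions. The comparisons return `1` for true and `0` for false. -/
inductive Expr : Type
  | const (c : ℕ) : Expr
  | reg (r : ℕ) : Expr
  | cell (a : ℕ) (i j : Expr) : Expr
  | succ (e : Expr) : Expr
  | pred (e : Expr) : Expr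
  | eq (e f : Expr) : Expr
  | lt (e f : Expr) : Expr

/-- The value of an expression in a state. -/
def Expr.eval (s : State) : Expr → ℕ
  | .const c => c
  | .reg r => s.reg r
  | .cell a i j => s.mem a (i.eval s) (j.eval s)
  | .succ e => e.eval s + 1
  | .pred e => e.eval s - 1
  | .eq e f => if e.eval s = f.eval s then 1 else 0
  | .lt e f => if e.eval s < f.eval s then 1 else 0

/-- The number of steps needed to evaluate an expression: its number of nodes. -/
def Expr.cost : Expr → ℕ
  | .const _ => 1
  | .reg _ => 1
  | .cell _ i j => i.cost + j.cost + 1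
  | .succ e => e.cost + 1
  | .pred e => e.cost + 1
  | .eq e f => e.cost + f.cost + 1
  | .lt e f => e.cost + f.cost + 1

/-- Programs. -/
inductive Prog : Type
  | skip : Prog
  | assign (r : ℕ) (e : Expr) : Prog
  | store (a : ℕ) (i j e : Expr) : Prog
  | seq (p q : Prog) : Prog
  | ite (e : Expr) (p q : Prog) : Prog
  | loop (e : Expr) (p : Prog) : Prog

/-- Change the content of register `r` to `x`. -/
def State.setReg (s : State) (r x : ℕ) : State :=
  ⟨fun r' => if r' = r then x else s.reg r', s.mem⟩

/-- Change the content of cell `(i, j)` of array `a` to `x`. -/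
def State.setMem (s : State) (a i j x : ℕ) : State :=
  ⟨s.reg, fun a' i' j' => if a' = a ∧ i' = i ∧ j' = j then x else s.mem a' i' j'⟩

/-- `Exec p s t s'`: the program `p`, started in state `s`, halts after exactly `t` steps in
state `s'`. The program `loop e p` repeats `p` as long as `e` has a nonzero value. -/
inductive Exec : Prog → State → ℕ → State → Prop
  | skip (s : State) : Exec .skip s 1 s
  | assign (s : State) (r : ℕ) (e : Expr) :
      Exec (.assign r e) s (e.cost + 1) (s.setReg r (e.eval s))
  | store (s : State) (a : ℕ) (i j e : Expr) :
      Exec (.store a i j e) s (i.cost + j.cost + e.cost + 1)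
        (s.setMem a (i.eval s) (j.eval s) (e.eval s))
  | seq {p q : Prog} {s s' s'' : State} {t t' : ℕ} :
      Exec p s t s' → Exec q s' t' s'' → Exec (.seq p q) s (t + t') s''
  | ite_true {e : Expr} {p q : Prog} {s s' : State} {t : ℕ} :
      e.eval s ≠ 0 → Exec p s t s' → Exec (.ite e p q) s (e.cost + 1 + t) s'
  | ite_false {e : Expr} {p q : Prog} {s s' : State} {t : ℕ} :
      e.eval s = 0 → Exec q s t s' → Exec (.ite e p q) s (e.cost + 1 + t) s'
  | loop_true {e : Expr} {p : Prog} {s s' s'' : State} {t t' : ℕ} :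
      e.eval s ≠ 0 → Exec p s t s' → Exec (.loop e p) s' t' s'' →
        Exec (.loop e p) s (e.cost + 1 + t + t') s''
  | loop_false {e : Expr} {p : Prog} {s : State} :
      e.eval s = 0 → Exec (.loop e p) s (e.cost + 1) s

/-- A program has at most one run from a given state. -/
theorem Exec.unique {p : Prog} {s s₁ : State} {t₁ : ℕ} (h₁ : Exec p s t₁ s₁) :
    ∀ {s₂ : State} {t₂ : ℕ}, Exec p s t₂ s₂ → t₁ = t₂ ∧ s₁ = s₂ := by
  induction h₁ with
  | skip s => intro _ _ h; cases h; exact ⟨rfl, rfl⟩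
  | assign s r e => intro _ _ h; cases h; exact ⟨rfl, rfl⟩
  | store s a i j e => intro _ _ h; cases h; exact ⟨rfl, rfl⟩
  | seq _ _ ih₁ ih₂ =>
    intro _ _ h
    cases h with
    | seq h₁ h₂ =>
      obtain ⟨rfl, rfl⟩ := ih₁ h₁
      obtain ⟨rfl, rfl⟩ := ih₂ h₂
      exact ⟨rfl, rfl⟩
  | ite_true he _ ih =>
    intro _ _ h
    cases h with
    | ite_true _ h => obtain ⟨rfl, rfl⟩ := ih h; exact ⟨rfl, rfl⟩
    | ite_false he' _ => exact absurd he' he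
  | ite_false he _ ih =>
    intro _ _ h
    cases h with
    | ite_true he' _ => exact absurd he he'
    | ite_false _ h => obtain ⟨rfl, rfl⟩ := ih h; exact ⟨rfl, rfl⟩
  | loop_true he _ _ ih₁ ih₂ =>
    intro _ _ h
    cases h with
    | loop_true _ h₁ h₂ =>
      obtain ⟨rfl, rfl⟩ := ih₁ h₁
      obtain ⟨rfl, rfl⟩ := ih₂ h₂
      exact ⟨rfl, rfl⟩
    | loop_false he' => exact absurd he' he
  | loop_false he =>
    intro _ _ h
    cases h with
    | loop_true he' _ _ => exact absurd he he'
    | loop_false _ => exact ⟨rfl, rfl⟩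

/-- The three numbers encoding a gate: its kind, then its qubits (first the target). -/
def Gate.code {n : ℕ} : Gate n → ℕ × ℕ × ℕ
  | .P i => (0, i, 0)
  | .H i => (1, i, 0)
  | .CX i j _ => (2, i, j)

/-- The initial state for a circuit `C`: register `0` holds the number of qubits, register `1` the
number of gates, and row `k` of array `0` the code of the `k`-th gate; all else is `0`. -/
def inputState {n : ℕ} (C : List (Gate n)) : State where
  reg r := if r = 0 then n else if r = 1 then C.length else 0
  mem a k c :=
    if a = 0 then
      match C[k]? with
      | none => 0
      | some g =>
        if c = 0 then g.code.1 else if c = 1 then g.code.2.1 else if c = 2 then g.code.2.2 else 0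
    else 0

/-- The state `s` holds the normal form `N` as output: `k` is in register `2`, the vectors
`w, b, u, v, d` are in column `0` of the arrays `1` to `5`, and the matrices `B, D, A` are in the
arrays `6` to `8`, entry by entry. -/
structure State.Holds {n : ℕ} (s : State) (N : NormalForm n) : Prop where
  k : (s.reg 2 : ℤ) = N.k
  w : ∀ i : Fin n, s.mem 1 i 0 = (N.w i).val
  b : ∀ i : Fin n, s.mem 2 i 0 = (N.b i).val
  u : ∀ i : Fin n, s.mem 3 i 0 = (N.u i).val
  v : ∀ i : Fin n, s.mem 4 i 0 = (N.v i).val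
  d : ∀ i : Fin n, s.mem 5 i 0 = (N.d i).val
  B : ∀ i j : Fin n, s.mem 6 i j = (N.B.1 i j).val
  D : ∀ i j : Fin n, s.mem 7 i j = (N.D.1 i j).val
  A : ∀ i j : Fin n, s.mem 8 i j = ((N.A : Matrix (Fin n) (Fin n) (ZMod 2)) i j).val

end Stab

/-!
The gates of the circuit are processed from the last to the first, each one multiplying a normal
form from the left. The identity has the normal form with `w = (1, …, 1)`, `A = 1` and all other
data zero, since `H_w` and `𝐇` cancel.

Up to `H_w` and the factor `√2⁻ⁿ`, the operator of a normal form has the entries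
`e^{iφ} f(y) (-1)^(y·z) g(z)` with `z = A x`, where `f` and `g` are the functions with values in the
fourth roots of unity described by the quadratic forms `(u, b, B)` and `(v, d, D)`
(`Tableau.amp`). A Hadamard gate toggles a bit of `w`. A substitution `y_i ↦ y_i + y_j`, which is a
CNOT gate on the core, is compensated in `y·z` by `z_j ↦ z_j + z_i`, that is, by a row operation
on `A` and the same substitution in `g` (`Tableau.core_cnoty`). It remains to move phase and CNOT
gates past the Hadamard gates in `H_w`, and this rests on one operation: multiplication of the
entries by `i^M`, where `M` is the sum mod 2 of the bits multiplied with `y_i` in the exponent of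
`-1`, that is, `M = u_i + z_i + N·y` with `N` the `i`-th row of `B` (`Tableau.argPhase`). Since
`i^(a ⊕ b) = i^a i^b (-1)^(ab)`, it changes `B` by complementing the pairs in `N`, and the
mixed terms `(N·y) z_i` are absorbed in `y·z` by row operations on `A`, in `O(n²)` steps.

* If `b_i = 0`, summing over the old bit forces the new bit at `i` to be `M`, so that
  `P_i H_i core = H_i (i^M core)` (`Tableau.phase_hadamard_core`).
* If `b_i = 1`, the sum over the old bit is a Gauss sum, and `H_i core` is again a core, with the
  entries multiplied by `e^{iπ/4} (-1)^(y_i) i^(-M)` (`Tableau.op_flip`). So `w_i` can be toggled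
  without changing the operator.

These two facts give the phase gate. A CNOT gate is one of the easy operations above unless its
target has `w_i = 0` and its control has `w_j = 1`; this case is reduced to the others
(`Tableau.op_gateCXHard`).

The matrix `A` is invertible because the operator of a circuit is, while the columns of the
operator of a normal form depend on `A x` only.

On the machine, all writing to the output arrays is toggling of bits. `Reach` is a total correctness
statement with a time bound for a program which transforms a tableau in memory, and each step on
tableaus is matched by a program with such a statement.
-/

namespace Stab

variable {n : ℕ}

noncomputable section

/-! ### Signs and powers of `i` -/

/-- The sign `(-1)^a`. -/
def sgn (a : ZMod 2) : ℂ := (-1) ^ a.val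

/-- The power `i^a`, where `a` is read as `0` or `1`. -/
def iota (a : ZMod 2) : ℂ := Complex.I ^ a.val

theorem zmod2_cases (a : ZMod 2) : a = 0 ∨ a = 1 := by revert a; decide

theorem zmod2_add_self (a : ZMod 2) : a + a = 0 := by revert a; decide

theorem zmod2_add_cancel (a b : ZMod 2) : a + b + b = a := by revert a b; decide

theorem zmod2_ne_one {a : ZMod 2} : a ≠ 1 ↔ a = 0 := by revert a; decide

theorem zmod2_one_add_one : (1 + 1 : ZMod 2) = 0 := rfl

theorem zmod2_val_one : (1 : ZMod 2).val = 1 := rfl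

@[simp] theorem sgn_zero : sgn 0 = 1 := by simp [sgn]
@[simp] theorem sgn_one : sgn 1 = -1 := by simp [sgn, zmod2_val_one]
@[simp] theorem iota_zero : iota 0 = 1 := by simp [iota]
@[simp] theorem iota_one : iota 1 = Complex.I := by simp [iota, zmod2_val_one]

theorem sgn_add (a b : ZMod 2) : sgn (a + b) = sgn a * sgn b := by
  rcases zmod2_cases a with rfl | rfl <;> rcases zmod2_cases b with rfl | rfl <;>
    simp [zmod2_one_add_one]

theorem sgn_mul_self (a : ZMod 2) : sgn a * sgn a = 1 := by
  rw [← sgn_add, zmod2_add_self, sgn_zero]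

theorem iota_add (a b : ZMod 2) : iota (a + b) = iota a * iota b * sgn (a * b) := by
  rcases zmod2_cases a with rfl | rfl <;> rcases zmod2_cases b with rfl | rfl <;>
    simp [zmod2_one_add_one]

theorem sgn_sum {α : Type*} (s : Finset α) (f : α → ZMod 2) :
    sgn (∑ i ∈ s, f i) = ∏ i ∈ s, sgn (f i) := by
  classical
  induction s using Finset.induction_on with
  | empty => simp
  | insert a s ha ih => rw [Finset.sum_insert ha, Finset.prod_insert ha, sgn_add, ih]

theorem sqrt_two_sq : (Real.sqrt 2 : ℂ) ^ 2 = 2 := by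
  rw [← Complex.ofReal_pow, Real.sq_sqrt (by norm_num)]; norm_num

theorem sqrt_two_ne_zero : (Real.sqrt 2 : ℂ) ≠ 0 := fun h => by
  have h2 := sqrt_two_sq
  rw [h] at h2; norm_num at h2

/-! ### Bit vectors -/

theorem sum_add_single_mul (c y : BitVec₂ n) (j : Fin n) (t : ZMod 2) :
    ∑ k, (c + (Pi.single j t : BitVec₂ n)) k * y k = ∑ k, c k * y k + t * y j := by
  simp [add_mul, Finset.sum_add_distrib, Pi.single_apply]

theorem sum_mul_add_single (y z : BitVec₂ n) (k : Fin n) (t : ZMod 2) :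
    ∑ l, y l * (z + (Pi.single k t : BitVec₂ n)) l = ∑ l, y l * z l + y k * t := by
  simp [mul_add, Finset.sum_add_distrib, Pi.single_apply]

theorem add_single_add_single (y : BitVec₂ n) (i : Fin n) (t : ZMod 2) :
    y + (Pi.single i t : BitVec₂ n) + (Pi.single i t : BitVec₂ n) = y := by
  rw [add_assoc, ← Pi.single_add, zmod2_add_self, Pi.single_zero, add_zero]

theorem ite_lt_succ (c : BitVec₂ n) (i l : Fin n) :
    (if (l : ℕ) < i + 1 then c l else 0)
      = (if (l : ℕ) < i then c l else 0) + if l = i then c i else 0 := by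
  rcases lt_trichotomy l i with h | h | h
  · have h1 : (l : ℕ) < i := h
    simp [h1, h.ne, Nat.lt_succ_of_lt h1]
  · subst h; simp
  · have h1 : (i : ℕ) < l := h
    simp [h.ne', h1.not_gt, show ¬ (l : ℕ) < i + 1 by omega]

/-! ### Quadratic forms with values in the fourth roots of unity -/

/-- Toggle the pair `{i, j}` in a set of pairs. In characteristic two nothing happens if `i = j`. -/
def CZSet.toggle (B : CZSet n) (i j : Fin n) : CZSet n :=
  ⟨B.1 + (Matrix.single i j 1 + Matrix.single j i 1), by
    constructor
    · rw [Matrix.IsSymm, Matrix.transpose_add, Matrix.transpose_add, Matrix.transpose_single,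
        Matrix.transpose_single, B.2.1.eq, add_comm (Matrix.single j i 1)]
    · intro a
      have : (Matrix.single i j (1 : ZMod 2)) a a = (Matrix.single j i (1 : ZMod 2)) a a := by
        simp [Matrix.single_apply, and_comm]
      rw [Matrix.add_apply, Matrix.add_apply, B.2.2, this, zmod2_add_self, zero_add]⟩

theorem CZSet.toggle_apply (B : CZSet n) (i j a b : Fin n) :
    (B.toggle i j).1 a b =
      B.1 a b + ((if i = a ∧ j = b then 1 else 0) + (if j = a ∧ i = b then 1 else 0)) := by
  simp [CZSet.toggle, Matrix.single_apply]

theorem CZSet.symm_apply (B : CZSet n) (i j : Fin n) : B.1 i j = B.1 j i := B.2.1.apply j i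

/-- Data `(l, d, B)` of the function `y ↦ (-1)^(l·y) i^(∑ d_k y_k) (-1)^(∑_{k<l} B_kl y_k y_l)`. -/
@[ext] structure QForm (n : ℕ) where
  lin : BitVec₂ n
  diag : BitVec₂ n
  off : CZSet n

namespace QForm

/-- The value of the function described by a quadratic form. -/
def val (Q : QForm n) (y : BitVec₂ n) : ℂ :=
  sgn (∑ k, Q.lin k * y k) * (∏ k, iota (Q.diag k * y k)) *
    sgn (∑ p : Fin n × Fin n with p.1 < p.2, Q.off.1 p.1 p.2 * (y p.1 * y p.2))

/-- Multiplication by `(-1)^(y_j)`. -/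
def z (j : Fin n) (Q : QForm n) : QForm n := { Q with lin := Q.lin + Pi.single j 1 }

/-- Multiplication by `i^(y_j)`; as `i² = -1`, a coefficient `1` of `y_j` is carried over to the
linear part. -/
def p (j : Fin n) (Q : QForm n) : QForm n :=
  { Q with
    lin := if Q.diag j = 1 then Q.lin + Pi.single j 1 else Q.lin
    diag := Q.diag + Pi.single j 1 }

/-- Multiplication by `(-1)^(y_j y_l)` if `j ≠ l`, and the identity if `j = l`. -/
def cz (j l : Fin n) (Q : QForm n) : QForm n := { Q with off := Q.off.toggle j l }

theorem val_z (Q : QForm n) (j : Fin n) (y : BitVec₂ n) : (Q.z j).val y = Q.val y * sgn (y j) := by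
  simp only [val, z, sum_add_single_mul, one_mul, sgn_add]; ring

theorem val_p (Q : QForm n) (j : Fin n) (y : BitVec₂ n) :
    (Q.p j).val y = Q.val y * iota (y j) := by
  have h1 : sgn (∑ k, (Q.p j).lin k * y k) = sgn (∑ k, Q.lin k * y k) * sgn (Q.diag j * y j) := by
    simp only [p]
    rcases zmod2_cases (Q.diag j) with h | h
    · simp [h]
    · simp [h, -Pi.add_apply, sum_add_single_mul, one_mul, sgn_add]
  have h2 : ∏ k, iota ((Q.p j).diag k * y k)
      = (∏ k, iota (Q.diag k * y k)) * (iota (y j) * sgn (Q.diag j * y j)) := by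
    have h3 : ∀ k, iota ((Q.p j).diag k * y k)
        = iota (Q.diag k * y k) * (if k = j then iota (y j) * sgn (Q.diag j * y j) else 1) := by
      intro k
      by_cases hk : k = j
      · subst hk
        have h4 : Q.diag k * y k * y k = Q.diag k * y k := by
          generalize Q.diag k = a; generalize y k = b; revert a b; decide
        simp [p, add_mul, iota_add, h4, mul_assoc]
      · simp [p, hk]
    simp only [h3, Finset.prod_mul_distrib, Finset.prod_ite_eq', Finset.mem_univ, if_true]
  rw [val, h1, h2, val]
  have h5 := sgn_mul_self (Q.diag j * y j)
  simp only [p]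
  linear_combination (sgn (∑ k, Q.lin k * y k) * (∏ k, iota (Q.diag k * y k)) * iota (y j) *
    sgn (∑ p : Fin n × Fin n with p.1 < p.2, Q.off.1 p.1 p.2 * (y p.1 * y p.2))) * h5

theorem sum_pairs_single (c : Fin n × Fin n → ZMod 2) (j l : Fin n) :
    ∑ p : Fin n × Fin n with p.1 < p.2, (if j = p.1 ∧ l = p.2 then 1 else 0) * c p
      = if j < l then c (j, l) else 0 := by
  have h : ∀ p : Fin n × Fin n, (if j = p.1 ∧ l = p.2 then (1 : ZMod 2) else 0) * c p
      = if p = (j, l) then c p else 0 := by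
    rintro ⟨a, b⟩
    by_cases h : j = a ∧ l = b
    · obtain ⟨rfl, rfl⟩ := h; simp
    · have h' : ¬ ((a, b) = (j, l)) := by
        intro h2; rw [Prod.mk.injEq] at h2; exact h ⟨h2.1.symm, h2.2.symm⟩
      simp only [h, h', if_false, zero_mul]
  simp only [h, Finset.sum_ite_eq', Finset.mem_filter, Finset.mem_univ, true_and]

theorem val_cz (Q : QForm n) {j l : Fin n} (hjl : j ≠ l) (y : BitVec₂ n) :
    (Q.cz j l).val y = Q.val y * sgn (y j * y l) := by
  have h : ∑ p : Fin n × Fin n with p.1 < p.2, (Q.off.toggle j l).1 p.1 p.2 * (y p.1 * y p.2)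
      = ∑ p : Fin n × Fin n with p.1 < p.2, Q.off.1 p.1 p.2 * (y p.1 * y p.2) + y j * y l := by
    simp only [CZSet.toggle_apply, add_mul, Finset.sum_add_distrib]
    rw [sum_pairs_single (fun p => y p.1 * y p.2) j l,
      sum_pairs_single (fun p => y p.1 * y p.2) l j]
    rcases lt_or_gt_of_ne hjl with h | h
    · simp [h, h.not_gt]
    · simp [h, h.not_gt, mul_comm]
  simp only [val, cz, h, sgn_add]; ring

@[simp] theorem cz_self (Q : QForm n) (j : Fin n) : Q.cz j j = Q := by
  ext1 <;> try rfl
  apply Subtype.ext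
  ext a b
  rw [cz, CZSet.toggle_apply, zmod2_add_self, add_zero]

/-- The change of the value when one bit is changed. -/
theorem val_add_single (Q : QForm n) (i : Fin n) (t : ZMod 2) (y : BitVec₂ n) :
    Q.val (y + (Pi.single i t : BitVec₂ n)) =
      Q.val y * (sgn (Q.lin i * t) * (iota (Q.diag i * t) * sgn (Q.diag i * t * y i)) *
        sgn (t * ∑ l, Q.off.1 i l * y l)) := by
  have h2 : ∏ k, iota (Q.diag k * (y + (Pi.single i t : BitVec₂ n)) k)
      = (∏ k, iota (Q.diag k * y k)) * (iota (Q.diag i * t) * sgn (Q.diag i * t * y i)) := by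
    have h3 : ∀ k, iota (Q.diag k * (y + (Pi.single i t : BitVec₂ n)) k) = iota (Q.diag k * y k) *
        (if k = i then iota (Q.diag i * t) * sgn (Q.diag i * t * y i) else 1) := by
      intro k
      by_cases hk : k = i
      · subst hk
        have h4 : Q.diag k * y k * (Q.diag k * t) = Q.diag k * t * y k := by
          have key : ∀ a b t : ZMod 2, a * b * (a * t) = a * t * b := by decide
          exact key _ _ _
        simp [mul_add, iota_add, h4, mul_assoc]
      · simp [hk]
    simp only [h3, Finset.prod_mul_distrib, Finset.prod_ite_eq', Finset.mem_univ, if_true]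
  have h3 : ∑ p : Fin n × Fin n with p.1 < p.2,
        Q.off.1 p.1 p.2 *
          ((y + (Pi.single i t : BitVec₂ n)) p.1 * (y + (Pi.single i t : BitVec₂ n)) p.2)
      = ∑ p : Fin n × Fin n with p.1 < p.2, Q.off.1 p.1 p.2 * (y p.1 * y p.2)
        + t * ∑ l, Q.off.1 i l * y l := by
    have h4 : ∀ p : Fin n × Fin n, p.1 < p.2 →
        Q.off.1 p.1 p.2 *
          ((y + (Pi.single i t : BitVec₂ n)) p.1 * (y + (Pi.single i t : BitVec₂ n)) p.2)
        = Q.off.1 p.1 p.2 * (y p.1 * y p.2) +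
          ((if p.1 = i then t * (Q.off.1 i p.2 * y p.2) else 0) +
            (if p.2 = i then t * (Q.off.1 i p.1 * y p.1) else 0)) := by
      rintro ⟨a, b⟩ hab
      simp only [Pi.add_apply]
      by_cases ha : a = i
      · have hb : b ≠ i := fun hb => by simp [ha, hb] at hab
        subst ha; simp [hb]; ring
      · by_cases hb : b = i
        · subst hb; simp [ha, Q.off.symm_apply b a]; ring
        · simp [ha, hb]
    rw [Finset.sum_congr rfl fun p hp => h4 p (Finset.mem_filter.1 hp).2, Finset.sum_add_distrib]
    congr 1
    rw [Finset.sum_filter, Fintype.sum_prod_type, Finset.mul_sum]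
    have h5 : ∀ a b : Fin n, (if a < b then
        (if a = i then t * (Q.off.1 i b * y b) else 0) +
          (if b = i then t * (Q.off.1 i a * y a) else 0) else 0)
        = (if a = i then if i < b then t * (Q.off.1 i b * y b) else 0 else 0) +
          (if b = i then if a < i then t * (Q.off.1 i a * y a) else 0 else 0) := by
      intro a b
      by_cases ha : a = i <;> by_cases hb : b = i <;> simp [ha, hb]
    simp only [h5, Finset.sum_add_distrib, Finset.sum_ite_eq', Finset.mem_univ, if_true]
    rw [Finset.sum_comm]
    simp only [Finset.sum_ite_eq', Finset.mem_univ, if_true]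
    rw [← Finset.sum_add_distrib]
    refine Finset.sum_congr rfl fun l _ => ?_
    rcases lt_trichotomy i l with h | h | h
    · simp [h, h.not_gt]
    · subst h; simp [Q.off.2.2]
    · simp [h, h.not_gt]
  rw [val, sum_mul_add_single, h2, h3, sgn_add, sgn_add, val]; ring

end QForm

/-! ### Bounded iteration -/

section ForAll

variable {α : Type*}

/-- `f (m-1) ∘ ⋯ ∘ f 1 ∘ f 0`, where the indices from `n` on are ignored. -/
def forUpTo (f : Fin n → α → α) (a : α) : ℕ → α
  | 0 => a
  | m + 1 => if h : m < n then f ⟨m, h⟩ (forUpTo f a m) else forUpTo f a m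

/-- `f (n-1) ∘ ⋯ ∘ f 1 ∘ f 0`. -/
def forAll (f : Fin n → α → α) (a : α) : α := forUpTo f a n

theorem forUpTo_succ (f : Fin n → α → α) (a : α) {m : ℕ} (h : m < n) :
    forUpTo f a (m + 1) = f ⟨m, h⟩ (forUpTo f a m) := by
  simp [forUpTo, h]

theorem forAll_induction {f : Fin n → α → α} {a : α} (P : ℕ → α → Prop) (h0 : P 0 a)
    (hs : ∀ (i : Fin n) (b : α), P i b → P (i + 1) (f i b)) : P n (forAll f a) := by
  suffices h : ∀ m ≤ n, P m (forUpTo f a m) from h n le_rfl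
  intro m
  induction m with
  | zero => intro _; exact h0
  | succ m ih =>
    intro hm
    rw [forUpTo_succ f a hm]
    exact hs ⟨m, hm⟩ _ (ih (Nat.le_of_succ_le hm))

theorem forAll_map {β : Type*} (g : β → α) (f : Fin n → α → α) (f' : Fin n → β → β)
    (h : ∀ i b, f i (g b) = g (f' i b)) (b : β) : forAll f (g b) = g (forAll f' b) := by
  suffices h : ∀ m ≤ n, forUpTo f (g b) m = g (forUpTo f' b m) from h n le_rfl
  intro m
  induction m with
  | zero => intro _; rfl
  | succ m ih =>
    intro hm
    rw [forUpTo_succ _ _ hm, forUpTo_succ _ _ hm, ih (Nat.le_of_succ_le hm), h]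

/-- The sum of the first `m` entries of `c`. -/
def partialSum (c : Fin n → ZMod 2) (m : ℕ) : ZMod 2 := ∑ l : Fin n, if (l : ℕ) < m then c l else 0

@[simp] theorem partialSum_zero (c : Fin n → ZMod 2) : partialSum c 0 = 0 := by simp [partialSum]

@[simp] theorem partialSum_all (c : Fin n → ZMod 2) : partialSum c n = ∑ l, c l := by
  simp [partialSum]

theorem partialSum_succ (c : Fin n → ZMod 2) (i : Fin n) :
    partialSum c (i + 1) = partialSum c i + c i := by
  simp only [partialSum, ite_lt_succ, Finset.sum_add_distrib, Finset.sum_ite_eq', Finset.mem_univ,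
    if_true]

end ForAll

namespace QForm

/-- The substitution `y_i ↦ y_i + y_j`. The entry at `(i, j)` is read before it is changed by the
last step, and the loop leaves row `i` as it is. For `l = j` the step of the loop is the identity:
the product `y_j y_j = y_j` is accounted for by the linear term. -/
def subst (i j : Fin n) (Q : QForm n) : QForm n :=
  let Q₁ := if Q.lin i = 1 then Q.z j else Q
  let Q₂ := if Q₁.off.1 i j = 1 then Q₁.z j else Q₁
  let Q₃ := forAll (fun l Q => if Q.off.1 i l = 1 then Q.cz j l else Q) Q₂
  if Q₃.diag i = 1 then (Q₃.p j).cz i j else Q₃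

theorem ite_z_val (Q : QForm n) (a : ZMod 2) (j : Fin n) (y : BitVec₂ n) :
    (if a = 1 then Q.z j else Q).val y = Q.val y * sgn (a * y j) := by
  rcases zmod2_cases a with rfl | rfl <;> simp [val_z]

/-- The loop in `QForm.subst` multiplies by `(-1)^(y_j ∑ B_il y_l)`, where the sum is over
`l ≠ j`. -/
theorem forAll_cz_spec (Q : QForm n) {i j : Fin n} (hij : i ≠ j) :
    let Q' := forAll (fun l Q => if Q.off.1 i l = 1 then Q.cz j l else Q) Q
    Q'.lin = Q.lin ∧ Q'.diag = Q.diag ∧ (∀ l, Q'.off.1 i l = Q.off.1 i l) ∧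
      ∀ y, Q'.val y = Q.val y * sgn ((∑ l, Q.off.1 i l * y l + Q.off.1 i j * y j) * y j) := by
  have h := forAll_induction (f := fun l Q => if Q.off.1 i l = 1 then Q.cz j l else Q) (a := Q)
    (fun m Q' => Q'.lin = Q.lin ∧ Q'.diag = Q.diag ∧ (∀ l, Q'.off.1 i l = Q.off.1 i l) ∧
      ∀ y, Q'.val y = Q.val y *
        sgn (partialSum (fun l => if l = j then 0 else Q.off.1 i l * y l) m * y j)) ?_ ?_
  · refine ⟨h.1, h.2.1, h.2.2.1, fun y => ?_⟩
    rw [h.2.2.2, partialSum_all]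
    have h3 : ∑ l, (if l = j then 0 else Q.off.1 i l * y l)
        = ∑ l, Q.off.1 i l * y l + Q.off.1 i j * y j := by
      have h4 : ∀ l, (if l = j then 0 else Q.off.1 i l * y l)
          = Q.off.1 i l * y l + if l = j then Q.off.1 i j * y j else 0 := by
        intro l
        by_cases hl : l = j
        · subst hl; simp [zmod2_add_self]
        · simp [hl]
      simp only [h4, Finset.sum_add_distrib, Finset.sum_ite_eq', Finset.mem_univ, if_true]
    rw [h3]
  · simp
  · rintro l Q' ⟨h1, h2, h3, h4⟩
    simp only [partialSum_succ]
    rw [h3]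
    rcases zmod2_cases (Q.off.1 i l) with h0 | h0
    · simpa [h0, h1, h2, h4] using h3
    · have hli : l ≠ i := by rintro rfl; simp [Q.off.2.2] at h0
      by_cases hl : l = j
      · subst hl
        simpa [h1, h2, h4] using h3
      · simp only [h0, if_true, hl, if_false, one_mul]
        refine ⟨h1, h2, fun a => ?_, fun y => ?_⟩
        · simp [cz, CZSet.toggle_apply, hij.symm, hli, h3]
        · rw [val_cz _ (Ne.symm hl), h4, add_mul, sgn_add, mul_comm (y j) (y l)]; ring

theorem val_subst (Q : QForm n) {i j : Fin n} (hij : i ≠ j) (y : BitVec₂ n) :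
    (Q.subst i j).val y = Q.val (y + (Pi.single i (y j) : BitVec₂ n)) := by
  simp only [subst]
  set Q₁ := if Q.lin i = 1 then Q.z j else Q with hQ₁
  set Q₂ := if Q₁.off.1 i j = 1 then Q₁.z j else Q₁ with hQ₂
  obtain ⟨h1, h2, h3, h4⟩ := forAll_cz_spec Q₂ hij
  set Q₃ := forAll (fun l Q => if Q.off.1 i l = 1 then Q.cz j l else Q) Q₂ with hQ₃
  have o1 : Q₁.off = Q.off := by rw [hQ₁]; split_ifs <;> rfl
  have o2 : Q₂.off = Q.off := by rw [hQ₂]; split_ifs <;> simp [o1, z]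
  have d1 : Q₁.diag = Q.diag := by rw [hQ₁]; split_ifs <;> rfl
  have d2 : Q₂.diag = Q.diag := by rw [hQ₂]; split_ifs <;> simp [d1, z]
  have v2 : Q₂.val y = Q.val y * sgn (Q.lin i * y j) * sgn (Q.off.1 i j * y j) := by
    rw [hQ₂, ite_z_val, hQ₁, ite_z_val, ← hQ₁, o1]
  have v3 : (if Q₃.diag i = 1 then (Q₃.p j).cz i j else Q₃).val y
      = Q₃.val y * (iota (Q.diag i * y j) * sgn (Q.diag i * y j * y i)) := by
    rw [h2, d2]
    rcases zmod2_cases (Q.diag i) with h | h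
    · simp [h]
    · simp [h, val_cz _ hij, val_p, mul_comm (y i), mul_assoc]
  rw [v3, h4, v2, o2, val_add_single]
  have e : (∑ l, Q.off.1 i l * y l + Q.off.1 i j * y j) * y j
      = y j * (∑ l, Q.off.1 i l * y l) + Q.off.1 i j * y j := by
    have : Q.off.1 i j * y j * y j = Q.off.1 i j * y j := by
      generalize Q.off.1 i j = a; generalize y j = b; revert a b; decide
    rw [add_mul, this, mul_comm]
  rw [e, sgn_add]
  have h5 := sgn_mul_self (Q.off.1 i j * y j)
  linear_combination (Q.val y * sgn (Q.lin i * y j) * sgn (y j * ∑ l, Q.off.1 i l * y l) *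
    (iota (Q.diag i * y j) * sgn (Q.diag i * y j * y i))) * h5

/-- If the diagonal is zero at `i`, then substituting `y_i ↦ y_i + y_j` changes neither the diagonal
nor the entry at `(i, j)`. -/
theorem subst_keep (Q : QForm n) {i j : Fin n} (hij : i ≠ j) (hd : Q.diag i = 0) :
    (Q.subst i j).diag = Q.diag ∧ (Q.subst i j).off.1 i j = Q.off.1 i j := by
  simp only [subst]
  set Q₁ := if Q.lin i = 1 then Q.z j else Q with hQ₁
  set Q₂ := if Q₁.off.1 i j = 1 then Q₁.z j else Q₁ with hQ₂
  obtain ⟨h1, h2, h3, h4⟩ := forAll_cz_spec Q₂ hij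
  have o1 : Q₁.off = Q.off := by rw [hQ₁]; split_ifs <;> rfl
  have o2 : Q₂.off = Q.off := by rw [hQ₂]; split_ifs <;> simp [o1, z]
  have d1 : Q₁.diag = Q.diag := by rw [hQ₁]; split_ifs <;> rfl
  have d2 : Q₂.diag = Q.diag := by rw [hQ₂]; split_ifs <;> simp [d1, z]
  rw [h2, d2, hd]
  simp only [zero_ne_one, if_false]
  exact ⟨h2.trans d2, (h3 j).trans (by rw [o2])⟩

/-- Multiplication by `i^(N·y mod 2)`, where `N` is the `i`-th row of the matrix of pairs. As `i` is
not in `N`, the loops do not change row `i`; each pair `l < k` in `N` is toggled once. -/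
def complement (i : Fin n) (Q : QForm n) : QForm n :=
  forAll (fun k Q => if Q.off.1 i k = 1 then
    forAll (fun l Q => if l < k then if Q.off.1 i l = 1 then Q.cz k l else Q else Q) (Q.p k)
    else Q) Q

/-- The inner loop in `QForm.complement` multiplies by `(-1)^(y_k ∑ B_il y_l)`, where the sum is
over `l < k`. -/
theorem forAll_lt_cz_spec (Q : QForm n) {i k : Fin n} (hki : k ≠ i) :
    let Q' := forAll (fun l Q => if l < k then if Q.off.1 i l = 1 then Q.cz k l else Q else Q) Q
    Q'.lin = Q.lin ∧ Q'.diag = Q.diag ∧ (∀ l, Q'.off.1 i l = Q.off.1 i l) ∧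
      ∀ y, Q'.val y = Q.val y * sgn (partialSum (fun l => Q.off.1 i l * y l) k * y k) := by
  have h := forAll_induction (a := Q)
    (f := fun l Q => if l < k then if Q.off.1 i l = 1 then Q.cz k l else Q else Q)
    (fun m Q' => Q'.lin = Q.lin ∧ Q'.diag = Q.diag ∧ (∀ l, Q'.off.1 i l = Q.off.1 i l) ∧
      ∀ y, Q'.val y = Q.val y *
        sgn (partialSum (fun l => if l < k then Q.off.1 i l * y l else 0) m * y k)) ?_ ?_
  · refine ⟨h.1, h.2.1, h.2.2.1, fun y => ?_⟩
    rw [h.2.2.2, partialSum_all]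
    rfl
  · simp
  · rintro l Q' ⟨h1, h2, h3, h4⟩
    simp only [partialSum_succ]
    by_cases hl : l < k
    · simp only [hl, if_true, h3]
      rcases zmod2_cases (Q.off.1 i l) with h0 | h0
      · simpa [h0, h1, h2, h4] using h3
      · have hli : l ≠ i := by rintro rfl; simp [Q.off.2.2] at h0
        simp only [h0, if_true, one_mul]
        refine ⟨h1, h2, fun a => ?_, fun y => ?_⟩
        · simp [cz, CZSet.toggle_apply, hki, hli, h3]
        · rw [val_cz _ hl.ne', h4, add_mul, sgn_add, mul_comm (y k) (y l)]; ring
    · simpa [hl, h1, h2, h4] using h3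

/-- The value is built up by `i^(a ⊕ b) = i^a i^b (-1)^(ab)`, with the sum of the previous bits
for `a`. -/
theorem complement_spec (Q : QForm n) (i : Fin n) :
    (Q.complement i).lin i = Q.lin i ∧ (∀ l, (Q.complement i).diag l = Q.diag l + Q.off.1 i l) ∧
      (∀ l, (Q.complement i).off.1 i l = Q.off.1 i l) ∧
      ∀ y, (Q.complement i).val y = Q.val y * iota (∑ l, Q.off.1 i l * y l) := by
  have h := forAll_induction (a := Q)
    (f := fun k Q => if Q.off.1 i k = 1 then
      forAll (fun l Q => if l < k then if Q.off.1 i l = 1 then Q.cz k l else Q else Q) (Q.p k)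
      else Q)
    (fun m Q' => Q'.lin i = Q.lin i ∧
      (∀ l, Q'.diag l = Q.diag l + if (l : ℕ) < m then Q.off.1 i l else 0) ∧
      (∀ l, Q'.off.1 i l = Q.off.1 i l) ∧
      ∀ y, Q'.val y = Q.val y * iota (partialSum (fun l => Q.off.1 i l * y l) m)) ?_ ?_
  · refine ⟨h.1, fun l => ?_, h.2.2.1, fun y => ?_⟩
    · rw [complement, h.2.1]; simp
    · rw [complement, h.2.2.2, partialSum_all]
  · simp
  · rintro k Q' ⟨h1, h2, h3, h4⟩
    simp only [partialSum_succ, h3]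
    rcases zmod2_cases (Q.off.1 i k) with h0 | h0
    · simp only [h0, zero_ne_one, if_false, zero_mul, add_zero]
      refine ⟨h1, fun l => ?_, h3, h4⟩
      rw [h2, ite_lt_succ (Q.off.1 i), h0, ite_self, add_zero]
    · have hki : k ≠ i := by rintro rfl; simp [Q.off.2.2] at h0
      obtain ⟨g1, g2, g3, g4⟩ := forAll_lt_cz_spec (Q'.p k) hki
      simp only [h0, if_true]
      refine ⟨?_, fun l => ?_, fun l => ?_, fun y => ?_⟩
      · rw [g1, ← h1]; simp only [p]; split_ifs <;> simp [hki.symm]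
      · rw [g2]
        simp only [p, Pi.add_apply, h2, Pi.single_apply, ite_lt_succ (Q.off.1 i), h0, add_assoc]
      · rw [g3]; exact h3 l
      · rw [g4, val_p, h4, one_mul, iota_add]
        simp only [show ∀ l, (Q'.p k).off.1 i l = Q.off.1 i l from h3]
        ring

end QForm

/-! ### Tableaus -/

/-- The data on which the algorithm works: a normal form whose matrix `A` is not yet known to be
invertible. The form `q false` is `(u, b, B)`, the form `q true` is `(v, d, D)`. -/
structure Tableau (n : ℕ) where
  w : BitVec₂ n
  q : Bool → QForm n
  A : Matrix (Fin n) (Fin n) (ZMod 2)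
  k : ℕ

/-- The eighth root of unity `e^(iπ/4)`. -/
def omega : ℂ := Complex.exp (Complex.I * (Real.pi / 4 : ℝ))

namespace Tableau

/-- Replace one of the two quadratic forms. -/
def setQ (T : Tableau n) (c : Bool) (Q : QForm n) : Tableau n :=
  { T with q := Function.update T.q c Q }

/-- Modify one of the two quadratic forms. -/
def mapQ (c : Bool) (f : QForm n → QForm n) (T : Tableau n) : Tableau n := T.setQ c (f (T.q c))

/-- Multiplication by `e^(iπc/4)`. -/
def phase (c : ℕ) (T : Tableau n) : Tableau n := { T with k := T.k + c }

/-- Multiplication by a Hadamard gate on qubit `i`. -/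
def toggleW (i : Fin n) (T : Tableau n) : Tableau n := { T with w := T.w + Pi.single i 1 }

/-- Toggle an entry of the matrix `A`. -/
def toggleA (i j : Fin n) (T : Tableau n) : Tableau n := { T with A := T.A + Matrix.single i j 1 }

/-- Add row `i` of `A` to row `k`. -/
def rowAdd (k i : Fin n) (T : Tableau n) : Tableau n :=
  forAll (fun l T => if T.A i l = 1 then T.toggleA k l else T) T

/-- Up to the factor `√2ⁿ`, the entries of the operator without its Hadamard gates `H_w`. -/
def amp (T : Tableau n) (y x : BitVec₂ n) : ℂ :=
  omega ^ T.k * (T.q false).val y * sgn (∑ l, y l * (T.A *ᵥ x) l) * (T.q true).val (T.A *ᵥ x)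

/-- The operator of a tableau without its Hadamard gates `H_w`. -/
def core (T : Tableau n) : Op n := Matrix.of fun y x => T.amp y x / (Real.sqrt 2 : ℂ) ^ n

/-- The operator of a tableau. -/
def op (T : Tableau n) : Op n := onQubits hadamardGate T.w * T.core

@[simp] theorem setQ_q_self (T : Tableau n) (c : Bool) (Q : QForm n) : (T.setQ c Q).q c = Q := by
  simp [setQ]

@[simp] theorem setQ_true_q_false (T : Tableau n) (Q : QForm n) :
    (T.setQ true Q).q false = T.q false := by
  simp [setQ]

@[simp] theorem setQ_false_q_true (T : Tableau n) (Q : QForm n) :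
    (T.setQ false Q).q true = T.q true := by
  simp [setQ]

@[simp] theorem setQ_setQ (T : Tableau n) (c : Bool) (Q Q' : QForm n) :
    (T.setQ c Q).setQ c Q' = T.setQ c Q' := by
  simp [setQ]

@[simp] theorem setQ_A (T : Tableau n) (c : Bool) (Q : QForm n) : (T.setQ c Q).A = T.A := rfl
@[simp] theorem setQ_k (T : Tableau n) (c : Bool) (Q : QForm n) : (T.setQ c Q).k = T.k := rfl

theorem rowAdd_spec (T : Tableau n) {k i : Fin n} (hki : k ≠ i) :
    (T.rowAdd k i).w = T.w ∧ (T.rowAdd k i).q = T.q ∧ (T.rowAdd k i).k = T.k ∧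
      ∀ a b, (T.rowAdd k i).A a b = T.A a b + if a = k then T.A i b else 0 := by
  have h := forAll_induction (a := T) (f := fun l T => if T.A i l = 1 then T.toggleA k l else T)
    (fun m T' => T'.w = T.w ∧ T'.q = T.q ∧ T'.k = T.k ∧ ∀ a b, T'.A a b =
      T.A a b + if a = k then if (b : ℕ) < m then T.A i b else 0 else 0) ?_ ?_
  · refine ⟨h.1, h.2.1, h.2.2.1, fun a b => ?_⟩
    rw [rowAdd, h.2.2.2]; simp
  · simp
  · rintro l T' ⟨h1, h2, h3, h4⟩
    have h5 : T'.A i l = T.A i l := by rw [h4]; simp [hki.symm]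
    simp only [h5, ite_lt_succ (T.A i) l]
    rcases zmod2_cases (T.A i l) with h0 | h0
    · simp [h0, h1, h2, h3, h4]
    · simp only [h0, if_true]
      refine ⟨h1, h2, h3, fun a b => ?_⟩
      change (T'.A + (Matrix.single k l 1 : Matrix (Fin n) (Fin n) (ZMod 2))) a b = _
      rw [Matrix.add_apply, h4, Matrix.single_apply]
      by_cases ha : a = k
      · subst ha; simp [eq_comm]; ring
      · simp [ha, Ne.symm ha]

theorem rowAdd_mulVec (T : Tableau n) {k i : Fin n} (hki : k ≠ i) (x : BitVec₂ n) :
    (T.rowAdd k i).A *ᵥ x = T.A *ᵥ x + (Pi.single k ((T.A *ᵥ x) i) : BitVec₂ n) := by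
  ext a
  simp only [Matrix.mulVec, dotProduct, (T.rowAdd_spec hki).2.2.2, Pi.add_apply, add_mul,
    Finset.sum_add_distrib, Pi.single_apply]
  congr 1
  split_ifs <;> simp

/-- The change of variables `z_k ↦ z_k + z_i` in `z = A x`. -/
def cnotz (k i : Fin n) (T : Tableau n) : Tableau n := (T.mapQ true (QForm.subst k i)).rowAdd k i

/-- With the new `z`, the quadratic form in `z` keeps its value, and `(-1)^(y·z)` acquires the
factor `(-1)^(y_k z_i)`. -/
theorem cnotz_spec (T : Tableau n) {k i : Fin n} (hki : k ≠ i) :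
    (T.cnotz k i).w = T.w ∧ (T.cnotz k i).q false = T.q false ∧
      (∀ x, ((T.cnotz k i).A *ᵥ x) i = (T.A *ᵥ x) i) ∧
      ∀ y x, (T.cnotz k i).amp y x = T.amp y x * sgn (y k * (T.A *ᵥ x) i) := by
  obtain ⟨h1, h2, h3, -⟩ := (T.mapQ true (QForm.subst k i)).rowAdd_spec hki
  have h4 : ∀ x, (T.cnotz k i).A *ᵥ x = T.A *ᵥ x + (Pi.single k ((T.A *ᵥ x) i) : BitVec₂ n) :=
    (T.mapQ true (QForm.subst k i)).rowAdd_mulVec hki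
  refine ⟨h1, ?_, fun x => ?_, fun y x => ?_⟩
  · rw [cnotz, h2, mapQ, setQ_true_q_false]
  · rw [h4]; simp [hki.symm]
  · have h5 : (T.cnotz k i).q = (T.mapQ true (QForm.subst k i)).q := h2
    have h6 : (T.cnotz k i).k = T.k := h3
    rw [amp, h4, h5, h6, mapQ, setQ_true_q_false, setQ_q_self, QForm.val_subst _ hki,
      sum_mul_add_single, sgn_add, Pi.add_apply, Pi.single_apply, if_neg hki.symm, add_zero,
      add_single_add_single, amp]
    ring

/-- Multiplication of the entries by `i^(N·y + z_i mod 2)`, where `z = A x` and `N` is the `i`-th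
row of `B`. -/
def rowPhase (i : Fin n) (T : Tableau n) : Tableau n :=
  (forAll (fun k T => if (T.q false).off.1 i k = 1 then T.cnotz k i else T)
    (T.mapQ false (QForm.complement i))).mapQ true (QForm.p i)

theorem amp_mapQ_false (T : Tableau n) (f : QForm n → QForm n) (y x : BitVec₂ n) (c : ℂ)
    (h : (f (T.q false)).val y = (T.q false).val y * c) :
    (T.mapQ false f).amp y x = T.amp y x * c := by
  simp only [amp, mapQ, setQ_q_self, setQ_false_q_true, setQ_A, setQ_k, h]; ring

theorem amp_mapQ_true (T : Tableau n) (f : QForm n → QForm n) (y x : BitVec₂ n) (c : ℂ)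
    (h : (f (T.q true)).val (T.A *ᵥ x) = (T.q true).val (T.A *ᵥ x) * c) :
    (T.mapQ true f).amp y x = T.amp y x * c := by
  simp only [amp, mapQ, setQ_q_self, setQ_true_q_false, setQ_A, setQ_k, h]; ring

theorem amp_phase (T : Tableau n) (c : ℕ) (y x : BitVec₂ n) :
    (T.phase c).amp y x = T.amp y x * omega ^ c := by
  simp only [amp, phase, pow_add]; ring

/-- The loop contributes the mixed factor `(-1)^((N·y) z_i)` of `i^(N·y + z_i mod 2)`. -/
theorem rowPhase_spec (T : Tableau n) (i : Fin n) :
    (T.rowPhase i).w = T.w ∧ (T.rowPhase i).q false = (T.q false).complement i ∧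
      (∀ x, ((T.rowPhase i).A *ᵥ x) i = (T.A *ᵥ x) i) ∧
      ∀ y x, (T.rowPhase i).amp y x =
        T.amp y x * iota (∑ l, (T.q false).off.1 i l * y l + (T.A *ᵥ x) i) := by
  have hc := (T.q false).complement_spec i
  have h := forAll_induction (a := T.mapQ false (QForm.complement i))
    (f := fun k T => if (T.q false).off.1 i k = 1 then T.cnotz k i else T)
    (fun m T' => T'.w = T.w ∧ T'.q false = (T.q false).complement i ∧
      (∀ x, (T'.A *ᵥ x) i = (T.A *ᵥ x) i) ∧
      ∀ y x, T'.amp y x = T.amp y x * iota (∑ l, (T.q false).off.1 i l * y l) *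
        sgn (partialSum (fun l => (T.q false).off.1 i l * y l) m * (T.A *ᵥ x) i)) ?_ ?_
  · simp only [rowPhase]
    set T' := forAll (fun k T => if (T.q false).off.1 i k = 1 then T.cnotz k i else T)
      (T.mapQ false (QForm.complement i))
    obtain ⟨h1, h2, h3, h4⟩ := h
    refine ⟨h1, ?_, h3, fun y x => ?_⟩
    · rw [mapQ, setQ_true_q_false, h2]
    · rw [amp_mapQ_true _ _ _ _ _ (QForm.val_p _ _ _), h4, h3, partialSum_all, iota_add]
      ring
  · refine ⟨rfl, by simp [mapQ], fun x => rfl, fun y x => ?_⟩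
    rw [amp_mapQ_false _ _ _ _ _ (hc.2.2.2 y)]
    simp
  · rintro k T' ⟨h1, h2, h3, h4⟩
    simp only [partialSum_succ, h2, hc.2.2.1]
    rcases zmod2_cases ((T.q false).off.1 i k) with h0 | h0
    · simp only [h0, zero_ne_one, if_false, zero_mul, add_zero]
      exact ⟨h1, h2, h3, h4⟩
    · have hki : k ≠ i := by rintro rfl; simp [(T.q false).off.2.2] at h0
      obtain ⟨g1, g2, g3, g4⟩ := T'.cnotz_spec hki
      simp only [h0, if_true, one_mul]
      refine ⟨g1.trans h1, g2.trans h2, fun x => (g3 x).trans (h3 x), fun y x => ?_⟩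
      rw [g4, h4, h3, add_mul, sgn_add]; ring

/-- The sum `u_i + N·y + z_i` of the bits which are multiplied by `y_i` in the exponent of `-1`,
where `z = A x` and `N` is the `i`-th row of `B`. -/
def arg (T : Tableau n) (i : Fin n) (y x : BitVec₂ n) : ZMod 2 :=
  ∑ l, (T.q false).off.1 i l * y l + (T.A *ᵥ x) i + (T.q false).lin i

/-- Multiplication of the entries by `i^(arg i)`. For `u_i = 1`, this uses
`i^(1 ⊕ t) = i · (i^t)³`. -/
def argPhase (i : Fin n) (T : Tableau n) : Tableau n :=
  if (T.q false).lin i = 1 then ((T.rowPhase i).rowPhase i).rowPhase i |>.phase 2 else T.rowPhase i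

theorem omega_sq : omega ^ 2 = Complex.I := by
  rw [omega, ← Complex.exp_nat_mul]
  have : ((2 : ℕ) : ℂ) * (Complex.I * ((Real.pi / 4 : ℝ) : ℂ)) = Real.pi / 2 * Complex.I := by
    push_cast; ring
  rw [this, Complex.exp_pi_div_two_mul_I]

theorem omega_eq : omega = (1 + Complex.I) / (Real.sqrt 2 : ℂ) := by
  have h0 := sqrt_two_ne_zero
  rw [omega, mul_comm, Complex.exp_mul_I, ← Complex.ofReal_cos, ← Complex.ofReal_sin,
    Real.cos_pi_div_four, Real.sin_pi_div_four]
  push_cast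
  field_simp
  rw [sqrt_two_sq]

theorem argPhase_spec (T : Tableau n) (i : Fin n) :
    (T.argPhase i).w = T.w ∧
      (∀ l, ((T.argPhase i).q false).diag l = (T.q false).diag l + (T.q false).off.1 i l) ∧
      (∀ l, ((T.argPhase i).q false).off.1 i l = (T.q false).off.1 i l) ∧
      (∀ y x, (T.argPhase i).arg i y x = T.arg i y x) ∧
      ∀ y x, (T.argPhase i).amp y x = T.amp y x * iota (T.arg i y x) := by
  have step : ∀ T : Tableau n, (T.rowPhase i).w = T.w ∧
      ((T.rowPhase i).q false).lin i = (T.q false).lin i ∧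
      (∀ l, ((T.rowPhase i).q false).diag l = (T.q false).diag l + (T.q false).off.1 i l) ∧
      (∀ l, ((T.rowPhase i).q false).off.1 i l = (T.q false).off.1 i l) ∧
      (∀ x, ((T.rowPhase i).A *ᵥ x) i = (T.A *ᵥ x) i) ∧
      ∀ y x, (T.rowPhase i).amp y x =
        T.amp y x * iota (∑ l, (T.q false).off.1 i l * y l + (T.A *ᵥ x) i) := by
    intro T
    obtain ⟨h1, h2, h3, h4⟩ := T.rowPhase_spec i
    obtain ⟨c1, c2, c3, -⟩ := (T.q false).complement_spec i
    rw [h2]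
    exact ⟨h1, c1, c2, c3, h3, h4⟩
  rw [argPhase]
  obtain ⟨a1, a2, a3, a4, a5, a6⟩ := step T
  rcases zmod2_cases ((T.q false).lin i) with h0 | h0
  · simp only [h0, zero_ne_one, if_false]
    refine ⟨a1, a3, a4, fun y x => ?_, fun y x => ?_⟩
    · simp only [arg, a2, a4, a5]
    · rw [a6, arg, h0, add_zero]
  · simp only [h0, if_true]
    obtain ⟨b1, b2, b3, b4, b5, b6⟩ := step (T.rowPhase i)
    obtain ⟨c1, c2, c3, c4, c5, c6⟩ := step ((T.rowPhase i).rowPhase i)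
    refine ⟨c1.trans (b1.trans a1), fun l => ?_, fun l => ?_, fun y x => ?_, fun y x => ?_⟩
    · refine (c3 l).trans ?_
      rw [b4, a4, b3, a4, a3, zmod2_add_cancel]
    · exact (c4 l).trans ((b4 l).trans (a4 l))
    · simp only [arg, phase, a2, a4, a5, b2, b4, b5, c2, c4, c5]
    · rw [amp_phase, c6, b6, a6, omega_sq, arg, h0]
      simp only [b4, b5, a4, a5]
      generalize ∑ l, (T.q false).off.1 i l * y l + (T.A *ᵥ x) i = t
      rcases zmod2_cases t with rfl | rfl
      · simp
      · simp only [iota_one, zmod2_one_add_one, iota_zero]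
        linear_combination T.amp y x * (Complex.I ^ 2 - 1) * Complex.I_sq

/-- Change one bit of `y`. -/
theorem amp_add_single (T : Tableau n) (i : Fin n) (y x : BitVec₂ n) :
    T.amp (y + (Pi.single i 1 : BitVec₂ n)) x = T.amp y x *
      (iota ((T.q false).diag i) * sgn ((T.q false).diag i * y i) * sgn (T.arg i y x)) := by
  rw [amp, sum_add_single_mul, QForm.val_add_single, arg, sgn_add, sgn_add, sgn_add, amp]
  simp only [mul_one, one_mul]
  ring

theorem amp_toggleW (T : Tableau n) (i : Fin n) (y x : BitVec₂ n) :
    (T.toggleW i).amp y x = T.amp y x := rfl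

/-- If `b_i = 1`, a Hadamard gate on qubit `i` can be absorbed; it is compensated by the Hadamard
gate in `H_w`. -/
def flip (i : Fin n) (T : Tableau n) : Tableau n :=
  ((((T.argPhase i).argPhase i).argPhase i).phase 1).mapQ false (QForm.z i) |>.toggleW i

theorem flip_spec (T : Tableau n) (i : Fin n) :
    (T.flip i).w = T.w + Pi.single i 1 ∧
      ∀ y x, (T.flip i).amp y x = T.amp y x * (omega * sgn (y i) * iota (T.arg i y x) ^ 3) := by
  obtain ⟨a1, -, -, a4, a5⟩ := T.argPhase_spec i
  obtain ⟨b1, -, -, b4, b5⟩ := (T.argPhase i).argPhase_spec i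
  obtain ⟨c1, -, -, -, c5⟩ := ((T.argPhase i).argPhase i).argPhase_spec i
  refine ⟨?_, fun y x => ?_⟩
  · rw [← a1, ← b1, ← c1]; rfl
  · rw [flip, amp_toggleW, amp_mapQ_false _ _ _ _ _ (QForm.val_z _ _ _), amp_phase, c5, b5, b4, a5,
      a4]
    ring

end Tableau

/-! ### Operators acting from the left -/

theorem tensor_mul (U V : Fin n → Op₁) : tensor U * tensor V = tensor fun i => U i * V i := by
  ext y x
  simp only [tensor, Matrix.mul_apply, Matrix.of_apply, ← Finset.prod_mul_distrib]
  rw [Finset.prod_univ_sum, Fintype.piFinset_univ]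

theorem tensor_one : (tensor fun _ => 1 : Op n) = 1 := by
  ext y x
  simp only [tensor, Matrix.of_apply, Matrix.one_apply]
  by_cases h : y = x
  · simp [h]
  · obtain ⟨i, hi⟩ := Function.ne_iff.1 h
    rw [if_neg h, Finset.prod_eq_zero (Finset.mem_univ i) (if_neg hi)]

theorem hadamardGate_apply (a b : ZMod 2) :
    hadamardGate a b = sgn (a * b) / (Real.sqrt 2 : ℂ) := by
  rw [hadamardGate, Matrix.of_apply]
  rcases zmod2_cases a with rfl | rfl <;> rcases zmod2_cases b with rfl | rfl <;>
    simp [zmod2_val_one]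

theorem hadamardGate_mul_self : hadamardGate * hadamardGate = 1 := by
  have h : ∀ a b : ZMod 2, (hadamardGate * hadamardGate) a b
      = (sgn 0 + sgn (a + b)) / (Real.sqrt 2 : ℂ) ^ 2 := by
    intro a b
    have huniv : (Finset.univ : Finset (ZMod 2)) = {0, 1} := rfl
    rw [Matrix.mul_apply, huniv, Finset.sum_pair zero_ne_one]
    simp only [hadamardGate_apply, mul_zero, zero_mul, mul_one, one_mul, sgn_add, sgn_zero]
    ring
  ext a b
  rw [h, sqrt_two_sq]
  rcases zmod2_cases a with rfl | rfl <;> rcases zmod2_cases b with rfl | rfl <;>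
    simp only [zmod2_one_add_one, add_zero, zero_add, sgn_zero, sgn_one] <;>
    norm_num [Matrix.one_apply]

theorem onQubit_mul_apply (U : Op₁) (i : Fin n) (M : Op n) (y x : BitVec₂ n) :
    (onQubit U i * M) y x = U (y i) (y i) * M y x +
      U (y i) (y i + 1) * M (y + (Pi.single i 1 : BitVec₂ n)) x := by
  have hne : y ≠ y + (Pi.single i 1 : BitVec₂ n) := fun h => by
    have := congrFun h i
    simp at this
  have hent : ∀ t : ZMod 2,
      onQubit U i y (y + (Pi.single i t : BitVec₂ n)) = U (y i) (y i + t) := by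
    intro t
    rw [onQubit, tensor, Matrix.of_apply, Finset.prod_eq_single i]
    · simp
    · intro j _ hj
      rw [if_neg hj, Pi.add_apply, Pi.single_eq_of_ne hj, add_zero, Matrix.one_apply_eq]
    · simp
  rw [Matrix.mul_apply,
    ← Finset.sum_subset (Finset.subset_univ {y, y + (Pi.single i 1 : BitVec₂ n)}),
    Finset.sum_pair hne, hent]
  · congr 2
    have := hent 0
    simpa using this
  · intro z _ hz
    have : ∃ j, j ≠ i ∧ y j ≠ z j := by
      by_contra! hcon
      apply hz
      rw [Finset.mem_insert, Finset.mem_singleton]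
      have hz' : z = y + (Pi.single i (y i + z i) : BitVec₂ n) := by
        ext j
        by_cases hj : j = i
        · subst hj; simp [← add_assoc, zmod2_add_self]
        · simp [hj, hcon j hj]
      rcases zmod2_cases (y i + z i) with h | h
      · left; rw [hz', h]; simp
      · right; rw [hz', h]
    obtain ⟨j, hji, hj⟩ := this
    rw [onQubit, tensor, Matrix.of_apply, Finset.prod_eq_zero (Finset.mem_univ j), zero_mul]
    simp [hji, hj]

theorem phaseGate_mul_apply (i : Fin n) (M : Op n) (y x : BitVec₂ n) :
    (onQubit phaseGate i * M) y x = iota (y i) * M y x := by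
  rw [onQubit_mul_apply]
  simp [phaseGate, iota]

theorem hadamardGate_mul_apply (i : Fin n) (M : Op n) (y x : BitVec₂ n) :
    (onQubit hadamardGate i * M) y x =
      (sgn (y i) * M y x + M (y + (Pi.single i 1 : BitVec₂ n)) x) / (Real.sqrt 2 : ℂ) := by
  have h : ∀ a : ZMod 2, a * a = a ∧ a * (a + 1) = 0 := by decide
  rw [onQubit_mul_apply, hadamardGate_apply, hadamardGate_apply, (h _).1, (h _).2, sgn_zero]
  ring

theorem update_eq_add_single (b : BitVec₂ n) (i : Fin n) (t : ZMod 2) :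
    Function.update b i (b i + t) = b + (Pi.single i t : BitVec₂ n) := by
  ext j
  by_cases hj : j = i
  · subst hj; simp
  · simp [hj]

theorem eq_add_single_iff {a b : BitVec₂ n} {i j : Fin n} (hij : i ≠ j) :
    a = b + (Pi.single i (b j) : BitVec₂ n) ↔ b = a + (Pi.single i (a j) : BitVec₂ n) := by
  constructor
  · intro h
    have : a j = b j := by rw [h]; simp [hij.symm]
    rw [this, h, add_single_add_single]
  · intro h
    have : b j = a j := by rw [h]; simp [hij.symm]
    rw [this, h, add_single_add_single]

theorem cnot_mul_apply {i j : Fin n} (hij : i ≠ j) (M : Op n) (y x : BitVec₂ n) :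
    (cnot i j * M) y x = M (y + (Pi.single i (y j) : BitVec₂ n)) x := by
  simp only [cnot, Matrix.mul_apply, Matrix.of_apply, update_eq_add_single, eq_add_single_iff hij,
    ite_mul, one_mul, zero_mul, Finset.sum_ite_eq', Finset.mem_univ, if_true]

theorem mul_cnot_apply (i j : Fin n) (M : Op n) (y x : BitVec₂ n) :
    (M * cnot i j) y x = M y (x + (Pi.single i (x j) : BitVec₂ n)) := by
  simp only [cnot, Matrix.mul_apply, Matrix.of_apply, update_eq_add_single, mul_ite, mul_one,
    mul_zero, Finset.sum_ite_eq', Finset.mem_univ, if_true]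

theorem onQubit_mul_onQubit (U V : Op₁) (i : Fin n) :
    onQubit U i * onQubit V i = onQubit (U * V) i := by
  rw [onQubit, onQubit, tensor_mul, onQubit]
  congr 1; ext1 j
  split_ifs <;> simp

theorem onQubit_one (i : Fin n) : onQubit 1 i = (1 : Op n) := by
  simp only [onQubit, ite_self, tensor_one]

theorem hadamard_mul_self (i : Fin n) :
    onQubit hadamardGate i * onQubit hadamardGate i = (1 : Op n) := by
  rw [onQubit_mul_onQubit, hadamardGate_mul_self, onQubit_one]

theorem onQubit_onQubits_comm (U V : Op₁) {i : Fin n} {w : BitVec₂ n} (hw : w i = 0) :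
    onQubit U i * onQubits V w = onQubits V w * onQubit U i := by
  rw [onQubit, onQubits, tensor_mul, tensor_mul]
  congr 1; ext1 k
  by_cases hi : k = i
  · subst hi; simp [hw]
  · simp [hi]

theorem onQubits_add_single (i : Fin n) (w : BitVec₂ n) :
    onQubits hadamardGate (w + Pi.single i 1)
      = onQubits hadamardGate w * onQubit hadamardGate i := by
  rw [onQubit, onQubits, onQubits, tensor_mul]
  congr 1; ext1 k
  by_cases hi : k = i
  · subst hi
    rcases zmod2_cases (w k) with h | h <;> simp [h, zmod2_one_add_one, hadamardGate_mul_self]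
  · simp [hi]

/-- Split off the Hadamard gate on a qubit with `w_i = 1`. -/
theorem onQubits_split {w : BitVec₂ n} {i : Fin n} (hw : w i = 1) :
    ∃ w' : BitVec₂ n, w' i = 0 ∧ (∀ j, j ≠ i → w' j = w j) ∧
      onQubits hadamardGate w = onQubits hadamardGate w' * onQubit hadamardGate i := by
  refine ⟨w + Pi.single i 1, by simp [hw, zmod2_one_add_one], fun j hj => by simp [hj], ?_⟩
  rw [← onQubits_add_single, add_single_add_single]

theorem hadamard_onQubits_comm (i : Fin n) (w : BitVec₂ n) :
    onQubit hadamardGate i * onQubits hadamardGate w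
      = onQubits hadamardGate w * onQubit hadamardGate i := by
  rw [onQubit, onQubits, tensor_mul, tensor_mul]
  congr 1; ext1 k
  split_ifs <;> simp

/-- An entry of either product vanishes unless the bits at the control `j` agree. -/
theorem cnot_onQubits_comm {i j : Fin n} (hij : i ≠ j) (U : Op₁) {w : BitVec₂ n} (hi : w i = 0)
    (hj : w j = 0) : cnot i j * onQubits U w = onQubits U w * cnot i j := by
  ext y x
  rw [cnot_mul_apply hij, mul_cnot_apply, onQubits, tensor, Matrix.of_apply, Matrix.of_apply]
  by_cases hxy : y j = x j
  · refine Finset.prod_congr rfl fun k _ => ?_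
    by_cases hk : k = i
    · subst hk
      have key : ∀ a b c : ZMod 2, a + c = b ↔ a = b + c := by decide
      simp [hi, hxy, Matrix.one_apply, key]
    · simp [hk]
  · rw [Finset.prod_eq_zero (Finset.mem_univ j), Finset.prod_eq_zero (Finset.mem_univ j)]
    · simp [hj, hij.symm, hxy]
    · simp [hj, hij.symm, hxy]

/-- The controlled sign `|y⟩ ↦ (-1)^(y_i y_j) |y⟩`. -/
def czOp (i j : Fin n) : Op n := Matrix.diagonal fun y => sgn (y i * y j)

theorem czOp_comm (i j : Fin n) : czOp i j = czOp j i := by simp only [czOp, mul_comm]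

theorem cnot_mul_hadamard {i j : Fin n} (hij : i ≠ j) :
    cnot i j * onQubit hadamardGate i = onQubit hadamardGate i * czOp i j := by
  ext y x
  have h := hadamardGate_mul_apply i (1 : Op n)
  rw [mul_one] at h
  rw [cnot_mul_apply hij, h, hadamardGate_mul_apply]
  congr 1
  have key : ∀ M : Op n, sgn (y i + y j) * M (y + (Pi.single i (y j) : BitVec₂ n)) x +
      M (y + (Pi.single i (y j) : BitVec₂ n) + (Pi.single i 1 : BitVec₂ n)) x =
      sgn (y i) * (sgn (y i * y j) * M y x) +
        sgn ((y i + 1) * y j) * M (y + (Pi.single i 1 : BitVec₂ n)) x := by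
    intro M
    rcases zmod2_cases (y j) with hj | hj
    · simp [hj]
    · rw [hj, add_single_add_single]
      rcases zmod2_cases (y i) with hi | hi <;> simp [hi, zmod2_one_add_one] <;> ring
  have h1 := key 1
  simp only [czOp, Matrix.diagonal_apply, Pi.add_apply, Pi.single_eq_same]
  rw [h1]
  by_cases e1 : y = x <;> by_cases e2 : y + (Pi.single i 1 : BitVec₂ n) = x <;>
    simp [Matrix.one_apply, e1, e2, hij.symm]

theorem cnot_eq {i j : Fin n} (hij : i ≠ j) :
    cnot i j = onQubit hadamardGate i * czOp i j * onQubit hadamardGate i := by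
  rw [← cnot_mul_hadamard hij, mul_assoc, hadamard_mul_self, mul_one]

theorem cnot_mul_hadamard_hadamard {i j : Fin n} (hij : i ≠ j) :
    cnot i j * (onQubit hadamardGate i * onQubit hadamardGate j)
      = onQubit hadamardGate i * onQubit hadamardGate j * cnot j i := by
  rw [← mul_assoc, cnot_mul_hadamard hij, cnot_eq hij.symm, czOp_comm j i]
  simp only [mul_assoc]
  rw [← mul_assoc (onQubit hadamardGate j) (onQubit hadamardGate j), hadamard_mul_self, one_mul]

/-- `(-1)^(ab) = i^a i^b (i^(a ⊕ b))³`. -/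
theorem czOp_eq {i j : Fin n} (hij : i ≠ j) :
    (czOp i j : Op n) = onQubit phaseGate j * (onQubit phaseGate i * (cnot i j *
      (onQubit phaseGate i * (onQubit phaseGate i * (onQubit phaseGate i * cnot i j))))) := by
  ext y x
  have h : ∀ y : BitVec₂ n, (cnot i j : Op n) y x
      = (1 : Op n) (y + (Pi.single i (y j) : BitVec₂ n)) x := by
    intro y
    have := cnot_mul_apply hij (1 : Op n) y x
    rwa [mul_one] at this
  have hj : (y + (Pi.single i (y j) : BitVec₂ n)) j = y j := by simp [hij.symm]
  simp only [phaseGate_mul_apply, cnot_mul_apply hij, h]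
  rw [hj, add_single_add_single, czOp, Matrix.diagonal_apply, Matrix.one_apply]
  simp only [Pi.add_apply, Pi.single_eq_same]
  by_cases hxy : y = x
  · rw [if_pos hxy, if_pos hxy]
    rcases zmod2_cases (y i) with hi | hi <;> rcases zmod2_cases (y j) with hj | hj <;>
      simp only [hi, hj, zmod2_one_add_one, add_zero, zero_add, mul_zero, mul_one,
        one_mul, sgn_zero, sgn_one, iota_zero, iota_one]
    · linear_combination (1 - Complex.I ^ 2) * Complex.I_sq
    · linear_combination (1 - Complex.I ^ 2) * Complex.I_sq
    · linear_combination -Complex.I_sq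
  · simp [hxy]

/-! ### The effect of the steps on the operator -/

namespace Tableau

theorem op_toggleW (T : Tableau n) (i : Fin n) :
    (T.toggleW i).op = onQubit hadamardGate i * T.op := by
  rw [op, op, ← mul_assoc, hadamard_onQubits_comm, ← onQubits_add_single]; rfl

theorem hadamard_core_apply (T : Tableau n) (i : Fin n) (y x : BitVec₂ n) :
    (onQubit hadamardGate i * T.core) y x =
      T.amp y x * (sgn (y i) + iota ((T.q false).diag i) * sgn ((T.q false).diag i * y i) *
        sgn (T.arg i y x)) / (Real.sqrt 2 : ℂ) / (Real.sqrt 2 : ℂ) ^ n := by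
  rw [hadamardGate_mul_apply, core, Matrix.of_apply, Matrix.of_apply, amp_add_single]
  ring

/-- For `b_i = 0`, the sum over the old bit vanishes unless the new bit `y_i` is `arg i`. -/
theorem phase_hadamard_core (T : Tableau n) {i : Fin n} (hd : (T.q false).diag i = 0) :
    onQubit phaseGate i * (onQubit hadamardGate i * T.core)
      = onQubit hadamardGate i * (T.argPhase i).core := by
  obtain ⟨-, h2, -, h4, h5⟩ := T.argPhase_spec i
  have hd' : ((T.argPhase i).q false).diag i = 0 := by
    rw [h2, hd, (T.q false).off.2.2, add_zero]
  ext y x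
  rw [phaseGate_mul_apply, hadamard_core_apply, hadamard_core_apply, hd, hd', h4, h5]
  have key : iota (y i) * (sgn (y i) + sgn (T.arg i y x))
      = iota (T.arg i y x) * (sgn (y i) + sgn (T.arg i y x)) := by
    rcases zmod2_cases (y i) with h | h <;> rcases zmod2_cases (T.arg i y x) with h' | h' <;>
      simp [h, h']
  simp only [iota_zero, zero_mul, sgn_zero, one_mul]
  linear_combination (T.amp y x / (Real.sqrt 2 : ℂ) / (Real.sqrt 2 : ℂ) ^ n) * key

theorem op_argPhase (T : Tableau n) {i : Fin n} (hw : T.w i = 1) (hd : (T.q false).diag i = 0) :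
    (T.argPhase i).op = onQubit phaseGate i * T.op := by
  obtain ⟨w', hw', -, hs⟩ := onQubits_split hw
  rw [op, op, (T.argPhase_spec i).1, hs, mul_assoc, mul_assoc, ← phase_hadamard_core T hd,
    ← mul_assoc, ← onQubit_onQubits_comm _ _ hw']
  simp only [mul_assoc]

theorem op_flip (T : Tableau n) {i : Fin n} (hd : (T.q false).diag i = 1) :
    (T.flip i).op = T.op := by
  obtain ⟨h1, h2⟩ := T.flip_spec i
  have hc : onQubit hadamardGate i * T.core = (T.flip i).core := by
    ext y x
    rw [hadamard_core_apply, hd, core, Matrix.of_apply, h2, omega_eq]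
    have key : sgn (y i) + Complex.I * sgn (y i) * sgn (T.arg i y x)
        = (1 + Complex.I) * sgn (y i) * iota (T.arg i y x) ^ 3 := by
      rcases zmod2_cases (T.arg i y x) with h | h
      · simp only [h, sgn_zero, iota_zero]; ring
      · simp only [h, sgn_one, iota_one]
        linear_combination (-sgn (y i) * (Complex.I ^ 2 - 1 + Complex.I)) * Complex.I_sq
    rw [iota_one, one_mul, key]; ring
  rw [op, h1, ← hc, onQubits_add_single, mul_assoc, ← mul_assoc (onQubit hadamardGate i),
    hadamard_mul_self, one_mul, op]

theorem op_p (T : Tableau n) {i : Fin n} (hw : T.w i = 0) :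
    (T.mapQ false (QForm.p i)).op = onQubit phaseGate i * T.op := by
  have hc : onQubit phaseGate i * T.core = (T.mapQ false (QForm.p i)).core := by
    ext y x
    rw [phaseGate_mul_apply, core, core, Matrix.of_apply, Matrix.of_apply,
      amp_mapQ_false _ _ _ _ _ (QForm.val_p _ _ _)]
    ring
  rw [op, op, ← mul_assoc, onQubit_onQubits_comm _ _ hw, mul_assoc, hc]; rfl

/-- A CNOT gate between qubits without Hadamard gates: the substitution `y_i ↦ y_i + y_j`. -/
def cnoty (i j : Fin n) (T : Tableau n) : Tableau n := (T.mapQ false (QForm.subst i j)).cnotz j i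

theorem core_cnoty (T : Tableau n) {i j : Fin n} (hij : i ≠ j) :
    (T.cnoty i j).core = cnot i j * T.core := by
  ext y x
  rw [cnot_mul_apply hij, core, core, Matrix.of_apply, Matrix.of_apply, cnoty,
    (cnotz_spec _ hij.symm).2.2.2, amp, amp, sum_add_single_mul, sgn_add]
  simp only [mapQ, setQ_q_self, setQ_false_q_true, setQ_A, setQ_k, QForm.val_subst _ hij]
  ring

theorem cnoty_w (T : Tableau n) {i j : Fin n} (hij : i ≠ j) : (T.cnoty i j).w = T.w :=
  (cnotz_spec _ hij.symm).1

theorem cnoty_q_false (T : Tableau n) {i j : Fin n} (hij : i ≠ j) :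
    (T.cnoty i j).q false = (T.q false).subst i j := by
  rw [cnoty, (cnotz_spec _ hij.symm).2.1, mapQ, setQ_q_self]

theorem op_cnoty (T : Tableau n) {i j : Fin n} (hij : i ≠ j) (hi : T.w i = 0) (hj : T.w j = 0) :
    (T.cnoty i j).op = cnot i j * T.op := by
  rw [op, op, ← mul_assoc, cnot_onQubits_comm hij _ hi hj, mul_assoc, core_cnoty T hij,
    cnoty_w T hij]

theorem op_cnoty_swap (T : Tableau n) {i j : Fin n} (hij : i ≠ j) (hi : T.w i = 1)
    (hj : T.w j = 1) : (T.cnoty j i).op = cnot i j * T.op := by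
  obtain ⟨w', hw', hn', hs'⟩ := onQubits_split hj
  obtain ⟨w, hw, hn, hs⟩ := onQubits_split ((hn' i hij).trans hi)
  have hwj : w j = 0 := by rw [hn j hij.symm, hw']
  rw [op, op, cnoty_w T hij.symm, core_cnoty T hij.symm, hs', hs]
  rw [mul_assoc (onQubits hadamardGate w), mul_assoc (onQubits hadamardGate w),
    mul_assoc (onQubits hadamardGate w), ← mul_assoc (cnot i j), cnot_onQubits_comm hij _ hw hwj,
    mul_assoc (onQubits hadamardGate w), ← mul_assoc (cnot i j), cnot_mul_hadamard_hadamard hij,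
    mul_assoc, mul_assoc, mul_assoc]

theorem op_cz (T : Tableau n) {i j : Fin n} (hij : i ≠ j) (hi : T.w i = 1) (hj : T.w j = 0) :
    (T.mapQ false (QForm.cz i j)).op = cnot i j * T.op := by
  have hc : czOp i j * T.core = (T.mapQ false (QForm.cz i j)).core := by
    ext y x
    rw [czOp, Matrix.diagonal_mul, core, core, Matrix.of_apply, Matrix.of_apply,
      amp_mapQ_false _ _ _ _ _ (QForm.val_cz _ hij _)]
    ring
  obtain ⟨w, hw, hn, hs⟩ := onQubits_split hi
  rw [op, op, ← hc]
  change onQubits hadamardGate T.w * _ = _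
  rw [hs, ← mul_assoc (cnot i j), ← mul_assoc (cnot i j),
    cnot_onQubits_comm hij _ hw ((hn j hij.symm).trans hj), mul_assoc _ (cnot i j),
    cnot_mul_hadamard hij]
  simp only [mul_assoc]

/-! ### Multiplication by a gate -/

/-- Multiplication by a phase gate. -/
def gateP (i : Fin n) (T : Tableau n) : Tableau n :=
  if T.w i = 1 then
    if (T.q false).diag i = 1 then (T.flip i).mapQ false (QForm.p i) else T.argPhase i
  else T.mapQ false (QForm.p i)

theorem op_gateP (T : Tableau n) (i : Fin n) : (T.gateP i).op = onQubit phaseGate i * T.op := by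
  rw [gateP]
  split_ifs with hw hd
  · rw [op_p, op_flip T hd]
    rw [(T.flip_spec i).1]; simp [hw, zmod2_one_add_one]
  · exact op_argPhase T hw (zmod2_ne_one.1 hd)
  · exact op_p T (zmod2_ne_one.1 hw)

/-- Multiplication by a CNOT gate with target `i` and control `j` if `w_i = 0`, `w_j = 1`. If a
diagonal entry `b_i` or `b_j` is `1`, a Hadamard gate can be absorbed, and if `B_ij = 1`, a phase
gate on the control qubit makes `b_i = 1`. Otherwise the CNOT gate is written with phase gates and
with CNOT gates between qubits with Hadamard gates. -/
def gateCXHard (i j : Fin n) (T : Tableau n) : Tableau n :=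
  if (T.q false).diag j = 1 then (T.flip j).cnoty i j
  else if (T.q false).diag i = 1 then (T.flip i).cnoty j i
  else if (T.q false).off.1 i j = 1 then
    (((((T.argPhase j).flip i).cnoty j i).gateP j).gateP j).gateP j
  else
    ((((((((T.toggleW i).cnoty j i).argPhase i).argPhase i).argPhase i).cnoty j i).argPhase
      i).argPhase j).toggleW i

theorem op_gateCXHard (T : Tableau n) {i j : Fin n} (hij : i ≠ j) (hi : T.w i = 0)
    (hj : T.w j = 1) : (T.gateCXHard i j).op = cnot i j * T.op := by
  rw [gateCXHard]
  split_ifs with h1 h2 h3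
  · have hw := (T.flip_spec j).1
    rw [op_cnoty _ hij, op_flip T h1]
    · rw [hw]; simp [hij, hi]
    · rw [hw]; simp [hj, zmod2_one_add_one]
  · have hw := (T.flip_spec i).1
    rw [op_cnoty_swap _ hij, op_flip T h2]
    · rw [hw]; simp [hi]
    · rw [hw]; simp [hij.symm, hj]
  · obtain ⟨a1, a2, -⟩ := T.argPhase_spec j
    have hd : ((T.argPhase j).q false).diag i = 1 := by
      rw [a2, zmod2_ne_one.1 h2, zero_add, CZSet.symm_apply, h3]
    have hw := ((T.argPhase j).flip_spec i).1
    rw [a1] at hw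
    rw [op_gateP, op_gateP, op_gateP, op_cnoty_swap _ hij, op_flip _ hd,
      op_argPhase T hj (zmod2_ne_one.1 h1)]
    · ext y x
      have h4 : ∀ a : ZMod 2, iota a * (iota a * (iota a * (iota a))) = 1 := by
        intro a
        rcases zmod2_cases a with rfl | rfl
        · simp
        · simp only [iota_one]; linear_combination (Complex.I ^ 2 - 1) * Complex.I_sq
      simp only [phaseGate_mul_apply, cnot_mul_apply hij, Pi.add_apply,
        Pi.single_eq_of_ne hij.symm, add_zero]
      linear_combination (T.op (y + (Pi.single i (y j) : BitVec₂ n)) x) * h4 (y j)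
    · rw [hw]; simp [hi]
    · rw [hw]; simp [hij.symm, hj]
  · replace h1 := zmod2_ne_one.1 h1
    replace h2 := zmod2_ne_one.1 h2
    replace h3 := zmod2_ne_one.1 h3
    -- All the steps keep `w_i = w_j = 1`, `b_i = b_j = 0` and `B_ij = 0`.
    let I (T : Tableau n) : Prop := (T.w i = 1 ∧ T.w j = 1) ∧ (T.q false).diag i = 0 ∧
      (T.q false).diag j = 0 ∧ (T.q false).off.1 i j = 0
    have hP : ∀ T : Tableau n, I T → I (T.argPhase i) := by
      rintro T ⟨i1, i2, i3, i4⟩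
      obtain ⟨a1, a2, a3, -⟩ := T.argPhase_spec i
      refine ⟨a1 ▸ i1, ?_, ?_, ?_⟩
      · rw [a2, i2, (T.q false).off.2.2, add_zero]
      · rw [a2, i3, i4, add_zero]
      · rw [a3, i4]
    have hC : ∀ T : Tableau n, I T → I (T.cnoty j i) := by
      rintro T ⟨i1, i2, i3, i4⟩
      obtain ⟨a1, a2⟩ := (T.q false).subst_keep hij.symm i3
      refine ⟨(T.cnoty_w hij.symm) ▸ i1, ?_, ?_, ?_⟩
      · rw [cnoty_q_false T hij.symm, a1, i2]
      · rw [cnoty_q_false T hij.symm, a1, i3]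
      · rw [cnoty_q_false T hij.symm, CZSet.symm_apply, a2, CZSet.symm_apply, i4]
    have oP : ∀ T : Tableau n, I T → (T.argPhase i).op = onQubit phaseGate i * T.op :=
      fun T h => op_argPhase T h.1.1 h.2.1
    have oC : ∀ T : Tableau n, I T → (T.cnoty j i).op = cnot i j * T.op :=
      fun T h => op_cnoty_swap T hij h.1.1 h.1.2
    have I0 : I (T.toggleW i) :=
      ⟨⟨by simp [toggleW, hi], by simp [toggleW, hij.symm, hj]⟩, h2, h1, h3⟩
    have I1 := hC _ I0
    have I2 := hP _ I1
    have I3 := hP _ I2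
    have I4 := hP _ I3
    have I5 := hC _ I4
    have I6 := hP _ I5
    rw [op_toggleW, op_argPhase _ I6.1.2 I6.2.2.1, oP _ I5, oC _ I4, oP _ I3, oP _ I2, oP _ I1,
      oC _ I0, op_toggleW]
    conv_rhs => rw [cnot_eq hij, czOp_eq hij]
    simp only [mul_assoc]

/-- Multiplication by a CNOT gate with target `i` and control `j`. -/
def gateCX (i j : Fin n) (T : Tableau n) : Tableau n :=
  if T.w i = 1 then
    if T.w j = 1 then T.cnoty j i else T.mapQ false (QForm.cz i j)
  else
    if T.w j = 1 then T.gateCXHard i j else T.cnoty i j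

theorem op_gateCX (T : Tableau n) {i j : Fin n} (hij : i ≠ j) :
    (T.gateCX i j).op = cnot i j * T.op := by
  rw [gateCX]
  split_ifs with hi hj hj
  · exact op_cnoty_swap T hij hi hj
  · exact op_cz T hij hi (zmod2_ne_one.1 hj)
  · exact op_gateCXHard T hij (zmod2_ne_one.1 hi) hj
  · exact op_cnoty T hij (zmod2_ne_one.1 hi) (zmod2_ne_one.1 hj)

/-- Multiplication by a gate. -/
def gate : Gate n → Tableau n → Tableau n
  | .P i => gateP i
  | .H i => toggleW i
  | .CX i j _ => gateCX i j

theorem op_gate (T : Tableau n) (g : Gate n) : (T.gate g).op = g.op * T.op := by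
  cases g with
  | P i => exact op_gateP T i
  | H i => exact op_toggleW T i
  | CX i j hij => exact op_gateCX T hij

end Tableau

/-! ### The operators of the normal form -/

theorem hadamardAll_apply (y x : BitVec₂ n) :
    hadamardAll n y x = sgn (∑ l, y l * x l) / (Real.sqrt 2 : ℂ) ^ n := by
  rw [hadamardAll, tensor, Matrix.of_apply, sgn_sum]
  simp only [hadamardGate_apply, Finset.prod_div_distrib, Finset.prod_const, Finset.card_univ,
    Fintype.card_fin]

theorem onQubits_diagonal (f : ZMod 2 → ℂ) (hf : f 0 = 1) (u : BitVec₂ n) :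
    onQubits (Matrix.diagonal f) u = Matrix.diagonal fun y => ∏ l, f (u l * y l) := by
  ext y x
  rw [onQubits, tensor, Matrix.of_apply, Matrix.diagonal_apply]
  by_cases h : y = x
  · subst h
    rw [if_pos rfl]
    refine Finset.prod_congr rfl fun l _ => ?_
    rcases zmod2_cases (u l) with h | h <;> simp [h, hf]
  · obtain ⟨i, hi⟩ := Function.ne_iff.1 h
    rw [if_neg h, Finset.prod_eq_zero (Finset.mem_univ i)]
    split_ifs <;> simp [hi]

theorem onQubits_pauliX_apply (u y x : BitVec₂ n) :
    onQubits pauliX u y x = if x = y + u then 1 else 0 := by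
  rw [onQubits, tensor, Matrix.of_apply]
  have key : ∀ a b c : ZMod 2, (if c = 1 then pauliX else 1) a b = if b = a + c then 1 else 0 := by
    intro a b c
    have h1 : ∀ a b : ZMod 2, a = b + 1 ↔ b = a + 1 := by decide
    rcases zmod2_cases c with rfl | rfl
    · simp [Matrix.one_apply, eq_comm]
    · simp [pauliX, h1 a b]
  simp only [key, Finset.prod_ite_zero, Finset.prod_const_one, Finset.mem_univ, true_implies,
    funext_iff, Pi.add_apply]

theorem czGate_eq (B : CZSet n) : czGate B = Matrix.diagonal fun y : BitVec₂ n =>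
    sgn (∑ p : Fin n × Fin n with p.1 < p.2, B.1 p.1 p.2 * (y p.1 * y p.2)) := by
  rw [czGate]
  congr 1; ext1 y
  rw [sgn_sum, Finset.prod_filter, Finset.prod_filter]
  refine Finset.prod_congr rfl fun p _ => ?_
  by_cases hp : p.1 < p.2
  · have h : ∀ a b : ZMod 2, (-1 : ℂ) ^ (a.val * b.val) = sgn (a * b) := by
      intro a b
      rcases zmod2_cases a with rfl | rfl <;> rcases zmod2_cases b with rfl | rfl <;>
        simp [zmod2_val_one]
    rcases zmod2_cases (B.1 p.1 p.2) with hB | hB <;> simp [hp, hB, h]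
  · simp [hp]

theorem isUnit_gate_op (g : Gate n) : IsUnit g.op := by
  cases g with
  | P i =>
    refine IsUnit.of_mul_eq_one
      (onQubit phaseGate i * (onQubit phaseGate i * onQubit phaseGate i)) ?_
    have h := phaseGate_mul_apply i (1 : Op n)
    rw [mul_one] at h
    ext y x
    simp only [Gate.op, phaseGate_mul_apply, h]
    rcases zmod2_cases (y i) with hi | hi
    · simp [hi]
    · rw [hi, iota_one]
      linear_combination ((Complex.I ^ 2 - 1) * (1 : Op n) y x) * Complex.I_sq
  | H i => exact IsUnit.of_mul_eq_one _ (hadamard_mul_self i)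
  | CX i j hij =>
    refine IsUnit.of_mul_eq_one (cnot i j) ?_
    ext y x
    have h := cnot_mul_apply hij (1 : Op n)
    rw [mul_one] at h
    rw [Gate.op, cnot_mul_apply hij, h]
    have hj : (y + (Pi.single i (y j) : BitVec₂ n)) j = y j := by simp [hij.symm]
    rw [hj, add_single_add_single]

theorem isUnit_circuitOp (C : List (Gate n)) : IsUnit (circuitOp C) := by
  induction C with
  | nil => simp [circuitOp]
  | cons g C ih => simpa [circuitOp] using (isUnit_gate_op g).mul ih

/-! ### From tableaus to normal forms -/

namespace Tableau

/-- The tableau of the identity: the Hadamard gates `H_w` on all qubits cancel those of the normal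
form. -/
def identity (n : ℕ) : Tableau n where
  w := fun _ => 1
  q := fun _ => ⟨0, 0, ⟨0, by simp, by simp⟩⟩
  A := 1
  k := 0

theorem op_identity : (identity n).op = 1 := by
  have h : (identity n).core = hadamardAll n := by
    ext y x
    rw [hadamardAll_apply, core, Matrix.of_apply]
    simp [amp, identity, QForm.val]
  have h1 : onQubits hadamardGate (identity n).w = hadamardAll n := by
    simp [onQubits, identity, hadamardAll]
  rw [op, h, h1, hadamardAll, tensor_mul]
  simp only [hadamardGate_mul_self, tensor_one]

/-- The tableau of a circuit. -/
def ofCircuit (C : List (Gate n)) : Tableau n := C.foldr gate (identity n)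

theorem op_ofCircuit (C : List (Gate n)) : (ofCircuit C).op = circuitOp C := by
  induction C with
  | nil => simpa [ofCircuit, circuitOp] using op_identity
  | cons g C ih =>
    have h : ofCircuit (g :: C) = (ofCircuit C).gate g := rfl
    rw [h, op_gate, ih]
    simp [circuitOp]

/-- The columns of the operator of a tableau depend on `A x` only, so `A` is invertible if the
operator is. -/
theorem isUnit_A (T : Tableau n) (h : IsUnit T.op) : IsUnit T.A := by
  rw [← Matrix.mulVec_injective_iff_isUnit]
  intro x x' hx
  have hcol : ∀ y, T.op y x = T.op y x' := by
    intro y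
    have : ∀ z, T.core z x = T.core z x' := by
      intro z
      simp only [core, Matrix.of_apply, amp, hx]
    simp only [op, Matrix.mul_apply, this]
  obtain ⟨V, hV⟩ := h.exists_left_inv
  by_contra hne
  have h1 : (V * T.op) x x = (V * T.op) x x' := by
    simp only [Matrix.mul_apply, hcol]
  rw [hV, Matrix.one_apply_eq, Matrix.one_apply_ne hne] at h1
  exact one_ne_zero h1

/-- The normal form given by a tableau with an invertible matrix. -/
def toNormalForm (T : Tableau n) (h : IsUnit T.A) : NormalForm n where
  w := T.w
  b := (T.q false).diag
  u := (T.q false).lin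
  v := (T.q true).lin
  d := (T.q true).diag
  B := (T.q false).off
  D := (T.q true).off
  A := h.unit
  k := T.k

theorem op_toNormalForm (T : Tableau n) (h : IsUnit T.A) : (T.toNormalForm h).op = T.op := by
  have hpow : Complex.exp (Complex.I * ((T.toNormalForm h).angle : ℂ)) = omega ^ T.k := by
    rw [omega, ← Complex.exp_nat_mul]
    congr 1
    simp [NormalForm.angle, toNormalForm]
    ring
  have hphase : ∀ b : BitVec₂ n, onQubits phaseGate b
      = Matrix.diagonal fun y => ∏ l, iota (b l * y l) :=
    onQubits_diagonal iota iota_zero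
  have hz : ∀ v : BitVec₂ n, onQubits pauliZ v = Matrix.diagonal fun y => sgn (∑ l, v l * y l) := by
    intro v
    simp only [sgn_sum]
    exact onQubits_diagonal sgn sgn_zero v
  rw [NormalForm.op, hpow, op]
  simp only [mul_assoc]
  change onQubits hadamardGate T.w * _ = _
  congr 1
  simp only [hphase, czGate_eq, hz]
  ext y x
  rw [Matrix.diagonal_mul, Matrix.diagonal_mul, Matrix.mul_smul, Matrix.smul_apply,
    ← mul_assoc (hadamardAll n), Matrix.mul_apply]
  have hX : ∀ z, (hadamardAll n * onQubits pauliX (T.toNormalForm h).u) y z =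
      sgn (∑ l, y l * z l) * sgn (∑ l, (T.q false).lin l * y l) / (Real.sqrt 2 : ℂ) ^ n := by
    intro z
    have key : ∀ z' : BitVec₂ n, z = z' + (T.q false).lin ↔ z' = z + (T.q false).lin := by
      intro z'
      constructor
      · rintro rfl; ext l; simp [zmod2_add_cancel]
      · rintro rfl; ext l; simp [zmod2_add_cancel]
    have hu : (T.toNormalForm h).u = (T.q false).lin := rfl
    simp only [Matrix.mul_apply, onQubits_pauliX_apply, hu, key, mul_ite, mul_one, mul_zero,
      Finset.sum_ite_eq', Finset.mem_univ, if_true, hadamardAll_apply]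
    have : ∑ l, y l * (z + (T.q false).lin) l = ∑ l, y l * z l + ∑ l, (T.q false).lin l * y l := by
      simp [mul_add, Finset.sum_add_distrib, mul_comm]
    rw [this, sgn_add]
  have hA : ∀ z, linearGate (T.toNormalForm h).A z x = if z = T.A *ᵥ x then 1 else 0 := fun z => rfl
  simp only [Matrix.diagonal_mul, hX, hA, mul_ite, mul_one, mul_zero, Finset.sum_ite_eq',
    Finset.mem_univ, if_true, smul_eq_mul]
  simp only [core, Matrix.of_apply, amp, QForm.val, toNormalForm]
  ring

end Tableau

end

/-! ### Tableaus in memory -/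

/-- The array holding the linear part of a quadratic form. -/
def linArr (c : Bool) : ℕ := bif c then 4 else 3

/-- The array holding the diagonal part of a quadratic form. -/
def diagArr (c : Bool) : ℕ := bif c then 5 else 2

/-- The array holding the pairs of a quadratic form. -/
def offArr (c : Bool) : ℕ := bif c then 7 else 6

/-- The state `s` holds the tableau `T`, in the places prescribed for the output. -/
structure Rep (s : State) (T : Tableau n) : Prop where
  size : s.reg 0 = n
  k : s.reg 2 = T.k
  w : ∀ i : Fin n, s.mem 1 i 0 = (T.w i).val
  lin : ∀ c (i : Fin n), s.mem (linArr c) i 0 = ((T.q c).lin i).val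
  diag : ∀ c (i : Fin n), s.mem (diagArr c) i 0 = ((T.q c).diag i).val
  off : ∀ c (i j : Fin n), s.mem (offArr c) i j = ((T.q c).off.1 i j).val
  A : ∀ i j : Fin n, s.mem 8 i j = (T.A i j).val

/-- The input and the registers below `m` are unchanged, except for register `2`, which holds the
phase. -/
structure Frame (m : ℕ) (s s' : State) : Prop where
  input : s'.mem 0 = s.mem 0
  reg : ∀ r < m, r ≠ 2 → s'.reg r = s.reg r

theorem Frame.refl (m : ℕ) (s : State) : Frame m s s := ⟨rfl, fun _ _ _ => rfl⟩

theorem Frame.trans {m : ℕ} {s s' s'' : State} (h : Frame m s s') (h' : Frame m s' s'') :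
    Frame m s s'' :=
  ⟨h'.input.trans h.input, fun r hr h2 => (h'.reg r hr h2).trans (h.reg r hr h2)⟩

theorem Frame.mono {m m' : ℕ} {s s' : State} (h : Frame m s s') (hm : m' ≤ m) : Frame m' s s' :=
  ⟨h.input, fun r hr h2 => h.reg r (hr.trans_le hm) h2⟩

/-- Register `r` is protected by `Frame m` and holds the index `i`. -/
structure Param (m : ℕ) (s : State) (r i : ℕ) : Prop where
  lt : r < m
  ne : r ≠ 2
  eq : s.reg r = i

theorem Param.frame {m : ℕ} {s s' : State} {r i : ℕ} (h : Param m s r i) (hf : Frame m s s') :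
    Param m s' r i :=
  ⟨h.lt, h.ne, (hf.reg r h.lt h.ne).trans h.eq⟩

theorem Param.mono {m m' : ℕ} {s : State} {r i : ℕ} (h : Param m s r i) (hm : m ≤ m') :
    Param m' s r i :=
  ⟨h.lt.trans_le hm, h.ne, h.eq⟩

/-- From the state `s`, the program `p` halts within `t` steps in a state which holds `T`, and it
respects `Frame m`. -/
def Reach (p : Prog) (s : State) (m t : ℕ) (T : Tableau n) : Prop :=
  ∃ t' s', Exec p s t' s' ∧ t' ≤ t ∧ Frame m s s' ∧ Rep s' T

namespace Reach

variable {p q : Prog} {s : State} {m t t' : ℕ} {T T₁ T₂ : Tableau n}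

theorem mono {m' : ℕ} (h : Reach p s m t T) (hm : m' ≤ m) (ht : t ≤ t') : Reach p s m' t' T := by
  obtain ⟨t₁, s', h1, h2, h3, h4⟩ := h
  exact ⟨t₁, s', h1, h2.trans ht, h3.mono hm, h4⟩

theorem skip (h : Rep s T) : Reach .skip s m 1 T :=
  ⟨1, s, .skip s, le_rfl, .refl m s, h⟩

theorem seq (h : Reach p s m t T₁)
    (h' : ∀ s₁, Frame m s s₁ → Rep s₁ T₁ → Reach q s₁ m t' T₂) :
    Reach (.seq p q) s m (t + t') T₂ := by
  obtain ⟨t₁, s₁, e₁, l₁, f₁, r₁⟩ := h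
  obtain ⟨t₂, s₂, e₂, l₂, f₂, r₂⟩ := h' s₁ f₁ r₁
  exact ⟨t₁ + t₂, s₂, .seq e₁ e₂, add_le_add l₁ l₂, f₁.trans f₂, r₂⟩

theorem ite {c : Prop} [Decidable c] {e : Expr} (he : e.eval s ≠ 0 ↔ c)
    (h₁ : c → Reach p s m t T₁) (h₂ : ¬c → Reach q s m t T₂) :
    Reach (.ite e p q) s m (e.cost + 1 + t) (if c then T₁ else T₂) := by
  by_cases hc : c
  · obtain ⟨t₁, s₁, e₁, l₁, f₁, r₁⟩ := h₁ hc
    rw [if_pos hc]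
    exact ⟨_, s₁, .ite_true (he.2 hc) e₁, by omega, f₁, r₁⟩
  · obtain ⟨t₁, s₁, e₁, l₁, f₁, r₁⟩ := h₂ hc
    rw [if_neg hc]
    exact ⟨_, s₁, .ite_false (not_not.1 fun h => hc (he.1 h)) e₁, by omega, f₁, r₁⟩

theorem when {c : Prop} [Decidable c] {e : Expr} (he : e.eval s ≠ 0 ↔ c) (ht : 1 ≤ t)
    (hT : Rep s T₂) (h₁ : c → Reach p s m t T₁) :
    Reach (.ite e p .skip) s m (e.cost + 1 + t) (if c then T₁ else T₂) :=
  ite he h₁ fun _ => (skip hT).mono le_rfl ht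

end Reach

theorem Rep.setReg {s : State} {T : Tableau n} (h : Rep s T) {r : ℕ} (hr : 2 < r) (x : ℕ) :
    Rep (s.setReg r x) T where
  size := by
    have h0 : 0 ≠ r := by omega
    simpa [State.setReg, h0] using h.size
  k := by simpa [State.setReg, hr.ne] using h.k
  w := h.w
  lin := h.lin
  diag := h.diag
  off := h.off
  A := h.A

theorem Frame.setReg (s : State) {m r : ℕ} (hr : m ≤ r) (x : ℕ) : Frame m s (s.setReg r x) :=
  ⟨rfl, fun r' hr' _ => by simp [State.setReg, (hr'.trans_le hr).ne]⟩

/-- The loop `for r < n do body`. -/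
def forLoop (r : ℕ) (body : Prog) : Prog :=
  .seq (.assign r (.const 0))
    (.loop (.lt (.reg r) (.reg 0)) (.seq body (.assign r (.succ (.reg r)))))

theorem reach_forLoop {body : Prog} {s : State} {r t : ℕ} {T : Tableau n}
    {f : Fin n → Tableau n → Tableau n} (hr : 2 < r) (hT : Rep s T)
    (hbody : ∀ (i : Fin n) s₁ T₁, Frame r s s₁ → Param (r + 1) s₁ r i → Rep s₁ T₁ →
      Reach body s₁ (r + 1) t (f i T₁)) :
    Reach (forLoop r body) s r (n * (t + 7) + 6) (forAll f T) := by
  have key : ∀ d m, m + d = n → ∀ s₁, Frame r s s₁ → s₁.reg r = m → Rep s₁ (forUpTo f T m) →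
      Reach (.loop (.lt (.reg r) (.reg 0)) (.seq body (.assign r (.succ (.reg r))))) s₁ r
        (d * (t + 7) + 4) (forUpTo f T n) := by
    intro d
    induction d with
    | zero =>
      intro m hm s₁ hf hreg hrep
      obtain rfl : m = n := hm
      refine ⟨_, s₁, .loop_false ?_, ?_, .refl _ _, hrep⟩
      · simp [Expr.eval, hreg, hrep.size]
      · simp [Expr.cost]
    | succ d ih =>
      intro m hm s₁ hf hreg hrep
      have hmn : m < n := by omega
      obtain ⟨t₂, s₂, e₂, l₂, f₂, r₂⟩ :=
        hbody ⟨m, hmn⟩ s₁ _ hf ⟨by omega, by omega, hreg⟩ hrep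
      have hreg₂ : s₂.reg r = m := by rw [f₂.reg r (by omega) (by omega), hreg]
      rw [← forUpTo_succ f T hmn] at r₂
      have hf₂ : Frame r s₁ (s₂.setReg r (m + 1)) :=
        (f₂.mono (by omega)).trans (.setReg s₂ le_rfl _)
      obtain ⟨t₃, s₃, e₃, l₃, f₃, r₃⟩ := ih (m + 1) (by omega) (s₂.setReg r (m + 1))
        (hf.trans hf₂) (by simp [State.setReg]) (r₂.setReg hr _)
      have e₂' : Exec (.assign r (.succ (.reg r))) s₂ 3 (s₂.setReg r (m + 1)) := by
        have := Exec.assign s₂ r (.succ (.reg r))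
        simpa [Expr.eval, Expr.cost, hreg₂] using this
      refine ⟨_, s₃, .loop_true ?_ (.seq e₂ e₂') e₃, ?_, hf₂.trans f₃, r₃⟩
      · simp [Expr.eval, hreg, hrep.size, hmn]
      · simp only [Expr.cost]
        rw [Nat.succ_mul]; omega
  obtain ⟨t₁, s₁, e₁, l₁, f₁, r₁⟩ := key n 0 (by omega) (s.setReg r 0) (.setReg s le_rfl 0)
    (by simp [State.setReg]) (hT.setReg hr 0)
  refine ⟨_, s₁, .seq (.assign s r (.const 0)) e₁, ?_, (Frame.setReg s le_rfl 0).trans f₁, r₁⟩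
  simp only [Expr.cost]; omega

/-! ### Elementary operations -/

/-- Toggle a bit of an array. -/
def toggle (a : ℕ) (e f : Expr) : Prog := .store a e f (.eq (.cell a e f) (.const 0))

/-- The effect of `toggle`. -/
def State.toggle (s : State) (a i j : ℕ) : State :=
  s.setMem a i j (if s.mem a i j = 0 then 1 else 0)

theorem exec_toggle (s : State) (a : ℕ) (e f : Expr) :
    Exec (toggle a e f) s (e.cost + f.cost + (e.cost + f.cost + 3) + 1)
      (s.toggle a (e.eval s) (f.eval s)) :=
  Exec.store s a e f _

theorem zmod2_val_ne_zero {a : ZMod 2} : a.val ≠ 0 ↔ a = 1 := by revert a; decide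

theorem zmod2_toggle_val (a : ZMod 2) : (if a = 0 then 1 else 0) = (a + 1).val := by
  revert a; decide

theorem Frame.toggle (m : ℕ) (s : State) {a : ℕ} (ha : a ≠ 0) (i j : ℕ) :
    Frame m s (s.toggle a i j) :=
  ⟨by ext i' j'; simp [State.toggle, State.setMem, ha.symm], fun _ _ _ => rfl⟩

theorem State.toggle_mem_ne (s : State) {a a' : ℕ} (ha : a' ≠ a) (i j i' j' : ℕ) :
    (s.toggle a i j).mem a' i' j' = s.mem a' i' j' := by
  simp [State.toggle, State.setMem, ha]

theorem State.toggle_mem_vec (s : State) (a : ℕ) (v : BitVec₂ n)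
    (h : ∀ i : Fin n, s.mem a i 0 = (v i).val) (i j : Fin n) :
    (s.toggle a i 0).mem a j 0 = ((v + (Pi.single i 1 : BitVec₂ n)) j).val := by
  by_cases hj : j = i
  · subst hj
    simp [State.toggle, State.setMem, h, zmod2_toggle_val]
  · have : (j : ℕ) ≠ i := fun h => hj (Fin.ext h)
    simp [State.toggle, State.setMem, h, hj, this]

theorem State.toggle_mem_mat (s : State) (a : ℕ) (M : Matrix (Fin n) (Fin n) (ZMod 2))
    (h : ∀ i j : Fin n, s.mem a i j = (M i j).val) (i j i' j' : Fin n) :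
    (s.toggle a i j).mem a i' j' =
      ((M + (Matrix.single i j 1 : Matrix (Fin n) (Fin n) (ZMod 2))) i' j').val := by
  rw [Matrix.add_apply, Matrix.single_apply]
  by_cases hij : i = i' ∧ j = j'
  · obtain ⟨rfl, rfl⟩ := hij
    simp [State.toggle, State.setMem, h, zmod2_toggle_val]
  · have : ¬ ((i' : ℕ) = i ∧ (j' : ℕ) = j) :=
      fun h => hij ⟨Fin.ext h.1.symm, Fin.ext h.2.symm⟩
    simp [State.toggle, State.setMem, h, hij, this]

/-- The entry of a vector at the index in register `r`. -/
def vecAt (a r : ℕ) : Expr := .cell a (.reg r) (.const 0)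

/-- The entry of a matrix at the indices in registers `r` and `r'`. -/
def matAt (a r r' : ℕ) : Expr := .cell a (.reg r) (.reg r')

/-- Toggle an entry of a vector. -/
def toggleVec (a r : ℕ) : Prog := toggle a (.reg r) (.const 0)

/-- Toggle an entry of a matrix. -/
def toggleMat (a r r' : ℕ) : Prog := toggle a (.reg r) (.reg r')

variable {s : State} {m r r' i₀ : ℕ} {T : Tableau n} {Q : QForm n} {c : Bool} {i j : Fin n}

theorem exec_toggleVec (a : ℕ) (hi : s.reg r = i₀) :
    Exec (toggleVec a r) s 8 (s.toggle a i₀ 0) := by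
  subst hi; exact exec_toggle s a (.reg r) (.const 0)

theorem exec_toggleMat (a : ℕ) {j₀ : ℕ} (hi : s.reg r = i₀) (hj : s.reg r' = j₀) :
    Exec (toggleMat a r r') s 8 (s.toggle a i₀ j₀) := by
  subst hi; subst hj; exact exec_toggle s a (.reg r) (.reg r')

theorem reach_toggleW (hT : Rep s T) (hi : Param m s r i) :
    Reach (toggleVec 1 r) s m 8 (T.toggleW i) := by
  refine ⟨8, _, exec_toggleVec 1 hi.eq, le_rfl, .toggle m s (by decide) _ _, ?_⟩
  constructor
  · exact hT.size
  · exact hT.k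
  · exact s.toggle_mem_vec 1 T.w hT.w i
  · intro c j; rw [State.toggle_mem_ne _ (by cases c <;> decide)]; exact hT.lin c j
  · intro c j; rw [State.toggle_mem_ne _ (by cases c <;> decide)]; exact hT.diag c j
  · intro c j l; rw [State.toggle_mem_ne _ (by cases c <;> decide)]; exact hT.off c j l
  · intro j l; rw [State.toggle_mem_ne _ (by decide)]; exact hT.A j l

theorem reach_toggleA (hT : Rep s T) (hi : Param m s r i) (hj : Param m s r' j) :
    Reach (toggleMat 8 r r') s m 8 (T.toggleA i j) := by
  refine ⟨8, _, exec_toggleMat 8 hi.eq hj.eq, le_rfl, .toggle m s (by decide) _ _, ?_⟩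
  constructor
  · exact hT.size
  · exact hT.k
  · intro j; rw [State.toggle_mem_ne _ (by decide)]; exact hT.w j
  · intro c j; rw [State.toggle_mem_ne _ (by cases c <;> decide)]; exact hT.lin c j
  · intro c j; rw [State.toggle_mem_ne _ (by cases c <;> decide)]; exact hT.diag c j
  · intro c j l; rw [State.toggle_mem_ne _ (by cases c <;> decide)]; exact hT.off c j l
  · exact s.toggle_mem_mat 8 T.A hT.A i j

/-- Add `a` to the phase. -/
def phaseProg : ℕ → Prog
  | 0 => .skip
  | a + 1 => .seq (.assign 2 (.succ (.reg 2))) (phaseProg a)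

theorem reach_phase (hT : Rep s T) (a : ℕ) : Reach (phaseProg a) s m (3 * a + 1) (T.phase a) := by
  induction a generalizing s T with
  | zero => exact .skip hT
  | succ a ih =>
    have h1 : Reach (.assign 2 (.succ (.reg 2))) s m 3 (T.phase 1) := by
      refine ⟨3, _, .assign s 2 (.succ (.reg 2)), le_rfl,
        ⟨rfl, fun r _ h2 => by simp [State.setReg, h2]⟩, ?_⟩
      constructor
      · simpa [State.setReg] using hT.size
      · simpa [State.setReg, Expr.eval, Tableau.phase] using hT.k
      · exact hT.w
      · exact hT.lin
      · exact hT.diag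
      · exact hT.off
      · exact hT.A
    have h2 : (T.phase 1).phase a = T.phase (a + 1) := by
      simp only [Tableau.phase, add_assoc, add_comm 1 a]
    rw [← h2]
    exact (h1.seq fun s₁ _ r₁ => ih r₁).mono le_rfl (by omega)

theorem Rep.setQ_self (hT : Rep s T) (c : Bool) : Rep s (T.setQ c (T.q c)) := by
  simpa [Tableau.setQ] using hT

theorem reach_toggle_lin (hT : Rep s (T.setQ c Q)) (hi : Param m s r i) :
    Reach (toggleVec (linArr c) r) s m 8 (T.setQ c (Q.z i)) := by
  refine ⟨8, _, exec_toggleVec _ hi.eq, le_rfl, .toggle m s (by cases c <;> decide) _ _, ?_⟩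
  constructor
  · exact hT.size
  · exact hT.k
  · intro j; rw [State.toggle_mem_ne _ (by cases c <;> decide)]; exact hT.w j
  · intro c' j
    have h := hT.lin c' j
    by_cases hc : c' = c
    · subst hc
      rw [Tableau.setQ_q_self]
      refine s.toggle_mem_vec _ Q.lin (fun j => ?_) i j
      rw [hT.lin, Tableau.setQ_q_self]
    · rw [State.toggle_mem_ne _ (by cases c <;> cases c' <;> first | decide | exact absurd rfl hc),
        h]
      simp [Tableau.setQ, hc]
  · intro c' j
    rw [State.toggle_mem_ne _ (by cases c <;> cases c' <;> decide), hT.diag]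
    by_cases hc : c' = c
    · subst hc; simp [QForm.z]
    · simp [Tableau.setQ, hc]
  · intro c' j l
    rw [State.toggle_mem_ne _ (by cases c <;> cases c' <;> decide), hT.off]
    by_cases hc : c' = c
    · subst hc; simp [QForm.z]
    · simp [Tableau.setQ, hc]
  · intro j l; rw [State.toggle_mem_ne _ (by cases c <;> decide)]; exact hT.A j l

theorem reach_toggle_diag (hT : Rep s (T.setQ c Q)) (hi : Param m s r i) :
    Reach (toggleVec (diagArr c) r) s m 8 (T.setQ c { Q with diag := Q.diag + Pi.single i 1 }) := by
  refine ⟨8, _, exec_toggleVec _ hi.eq, le_rfl, .toggle m s (by cases c <;> decide) _ _, ?_⟩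
  constructor
  · exact hT.size
  · exact hT.k
  · intro j; rw [State.toggle_mem_ne _ (by cases c <;> decide)]; exact hT.w j
  · intro c' j
    rw [State.toggle_mem_ne _ (by cases c <;> cases c' <;> decide), hT.lin]
    by_cases hc : c' = c
    · subst hc; simp
    · simp [Tableau.setQ, hc]
  · intro c' j
    have h := hT.diag c' j
    by_cases hc : c' = c
    · subst hc
      rw [Tableau.setQ_q_self]
      refine s.toggle_mem_vec _ Q.diag (fun j => ?_) i j
      rw [hT.diag, Tableau.setQ_q_self]
    · rw [State.toggle_mem_ne _ (by cases c <;> cases c' <;> first | decide | exact absurd rfl hc),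
        h]
      simp [Tableau.setQ, hc]
  · intro c' j l
    rw [State.toggle_mem_ne _ (by cases c <;> cases c' <;> decide), hT.off]
    by_cases hc : c' = c
    · subst hc; simp
    · simp [Tableau.setQ, hc]
  · intro j l; rw [State.toggle_mem_ne _ (by cases c <;> decide)]; exact hT.A j l

/-- Toggle a pair of a quadratic form. -/
def czProg (c : Bool) (r r' : ℕ) : Prog :=
  .seq (toggleMat (offArr c) r r') (toggleMat (offArr c) r' r)

theorem reach_cz (hT : Rep s (T.setQ c Q)) (hi : Param m s r i) (hj : Param m s r' j) :
    Reach (czProg c r r') s m 16 (T.setQ c (Q.cz i j)) := by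
  have h0 : offArr c ≠ 0 := by cases c <;> decide
  have e₁ := exec_toggleMat (offArr c) hi.eq hj.eq
  have f₁ := Frame.toggle m s h0 i j
  have e₂ := exec_toggleMat (offArr c) (hj.frame f₁).eq (hi.frame f₁).eq
  refine ⟨16, _, .seq e₁ e₂, le_rfl, f₁.trans (.toggle m _ h0 _ _), ?_⟩
  constructor
  · exact hT.size
  · exact hT.k
  · intro j
    rw [State.toggle_mem_ne _ (by cases c <;> decide),
      State.toggle_mem_ne _ (by cases c <;> decide)]
    exact hT.w j
  · intro c' j
    rw [State.toggle_mem_ne _ (by cases c <;> cases c' <;> decide),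
      State.toggle_mem_ne _ (by cases c <;> cases c' <;> decide), hT.lin]
    by_cases hc : c' = c
    · subst hc; simp [QForm.cz]
    · simp [Tableau.setQ, hc]
  · intro c' j
    rw [State.toggle_mem_ne _ (by cases c <;> cases c' <;> decide),
      State.toggle_mem_ne _ (by cases c <;> cases c' <;> decide), hT.diag]
    by_cases hc : c' = c
    · subst hc; simp [QForm.cz]
    · simp [Tableau.setQ, hc]
  · intro c' j' l'
    have h := hT.off c' j' l'
    by_cases hc : c' = c
    · subst hc
      rw [Tableau.setQ_q_self]
      have h1 : ∀ a b : Fin n, s.mem (offArr c') a b = (Q.off.1 a b).val := by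
        intro a b; rw [hT.off, Tableau.setQ_q_self]
      have h2 := State.toggle_mem_mat _ (offArr c') _ (s.toggle_mem_mat _ _ h1 i j) j i j' l'
      rw [h2, add_assoc]; rfl
    · rw [State.toggle_mem_ne _ (by cases c <;> cases c' <;> first | decide | exact absurd rfl hc),
        State.toggle_mem_ne _ (by cases c <;> cases c' <;> first | decide | exact absurd rfl hc),
        h]
      simp [Tableau.setQ, hc]
  · intro j l
    rw [State.toggle_mem_ne _ (by cases c <;> decide),
      State.toggle_mem_ne _ (by cases c <;> decide)]
    exact hT.A j l

theorem Rep.test_w (hT : Rep s T) (hi : Param m s r i) :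
    (vecAt 1 r).eval s ≠ 0 ↔ T.w i = 1 := by
  simp only [vecAt, Expr.eval, hi.eq, hT.w, zmod2_val_ne_zero]

theorem Rep.test_lin (hT : Rep s T) (hi : Param m s r i) :
    (vecAt (linArr c) r).eval s ≠ 0 ↔ (T.q c).lin i = 1 := by
  simp only [vecAt, Expr.eval, hi.eq, hT.lin, zmod2_val_ne_zero]

theorem Rep.test_diag (hT : Rep s T) (hi : Param m s r i) :
    (vecAt (diagArr c) r).eval s ≠ 0 ↔ (T.q c).diag i = 1 := by
  simp only [vecAt, Expr.eval, hi.eq, hT.diag, zmod2_val_ne_zero]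

theorem Rep.test_off (hT : Rep s T) (hi : Param m s r i) (hj : Param m s r' j) :
    (matAt (offArr c) r r').eval s ≠ 0 ↔ (T.q c).off.1 i j = 1 := by
  simp only [matAt, Expr.eval, hi.eq, hj.eq, hT.off, zmod2_val_ne_zero]

theorem Rep.test_A (hT : Rep s T) (hi : Param m s r i) (hj : Param m s r' j) :
    (matAt 8 r r').eval s ≠ 0 ↔ T.A i j = 1 := by
  simp only [matAt, Expr.eval, hi.eq, hj.eq, hT.A, zmod2_val_ne_zero]

/-- The program for `QForm.p`. -/
def pProg (c : Bool) (r : ℕ) : Prog :=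
  .seq (.ite (vecAt (diagArr c) r) (toggleVec (linArr c) r) .skip) (toggleVec (diagArr c) r)

theorem reach_p (hT : Rep s (T.setQ c Q)) (hi : Param m s r i) :
    Reach (pProg c r) s m 20 (T.setQ c (Q.p i)) := by
  have h1 : Reach (.ite (vecAt (diagArr c) r) (toggleVec (linArr c) r) .skip) s m 12
      (T.setQ c (if Q.diag i = 1 then Q.z i else Q)) := by
    have := Reach.when (hT.test_diag hi (c := c)) (by norm_num) hT fun _ => reach_toggle_lin hT hi
    rw [Tableau.setQ_q_self, ← apply_ite (T.setQ c)] at this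
    exact this
  have h2 := h1.seq fun s₁ f₁ r₁ => reach_toggle_diag r₁ (hi.frame f₁)
  have h3 : ({ (if Q.diag i = 1 then Q.z i else Q) with
      diag := (if Q.diag i = 1 then Q.z i else Q).diag + Pi.single i 1 } : QForm n) = Q.p i := by
    rw [QForm.p]; split_ifs <;> rfl
  rw [h3] at h2
  exact h2

/-! ### The programs for the steps -/

/-- The factor in the time bounds that depends on the number of qubits. -/
def size (n : ℕ) : ℕ := max n 1

theorem le_size (n : ℕ) : n ≤ size n := le_max_left n 1

theorem one_le_size (n : ℕ) : 1 ≤ size n := le_max_right n 1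

theorem size_le_sq (n : ℕ) : size n ≤ size n ^ 2 := by
  have := one_le_size n
  nlinarith

theorem mul_size_le_sq (n : ℕ) : n * size n ≤ size n ^ 2 := by
  rw [pow_two]; exact Nat.mul_le_mul_right _ (le_size n)

variable {s : State} {m r r' : ℕ} {T : Tableau n} {Q : QForm n} {c : Bool} {i j : Fin n}

theorem Reach.mapQ {p : Prog} {t : ℕ} {f : QForm n → QForm n}
    (h : ∀ Q, Rep s (T.setQ c Q) → Reach p s m t (T.setQ c (f Q))) (hT : Rep s T) :
    Reach p s m t (T.mapQ c f) :=
  h _ (hT.setQ_self c)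

/-- A loop whose body modifies one of the quadratic forms. -/
theorem reach_forLoop_setQ {body : Prog} {t : ℕ} {f : Fin n → QForm n → QForm n} (hr : 2 < r)
    (hT : Rep s (T.setQ c Q))
    (hbody : ∀ (i : Fin n) s₁ (T₁ : Tableau n) Q₁, Frame r s s₁ → Param (r + 1) s₁ r i →
      Rep s₁ (T₁.setQ c Q₁) → Reach body s₁ (r + 1) t (T₁.setQ c (f i Q₁))) :
    Reach (forLoop r body) s r (n * (t + 7) + 6) (T.setQ c (forAll f Q)) := by
  rw [← forAll_map (T.setQ c) (fun i T => T.mapQ c (f i)) f (fun i Q => by simp [Tableau.mapQ])]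
  exact reach_forLoop hr hT fun i s₁ T₁ hf hi hT₁ =>
    Reach.mapQ (fun Q₁ hQ => hbody i s₁ T₁ Q₁ hf hi hQ) hT₁

/-- The program for `QForm.subst`. Here and below, register `7` is the variable of the innermost
loop, and register `6` that of the loop around it. -/
def substProg (c : Bool) (r r' : ℕ) : Prog :=
  .seq (.ite (vecAt (linArr c) r) (toggleVec (linArr c) r') .skip) <|
  .seq (.ite (matAt (offArr c) r r') (toggleVec (linArr c) r') .skip) <|
  .seq (forLoop 7 (.ite (matAt (offArr c) r 7) (czProg c r' 7) .skip)) <|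
  .ite (vecAt (diagArr c) r) (.seq (pProg c r') (czProg c r r')) .skip

/-- `Reach.when` for a modification of one of the quadratic forms. -/
theorem Reach.whenQ {C : Prop} [Decidable C] {e : Expr} {p : Prog} {t : ℕ} {Q₁ : QForm n}
    (he : e.eval s ≠ 0 ↔ C) (ht : 1 ≤ t) (hT : Rep s (T.setQ c Q))
    (h : C → Reach p s m t (T.setQ c Q₁)) :
    Reach (.ite e p .skip) s m (e.cost + 1 + t) (T.setQ c (if C then Q₁ else Q)) := by
  rw [apply_ite (T.setQ c)]
  exact Reach.when he ht hT h

theorem test_lin_setQ (hT : Rep s (T.setQ c Q)) (hi : Param m s r i) :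
    (vecAt (linArr c) r).eval s ≠ 0 ↔ Q.lin i = 1 := by
  simpa using hT.test_lin hi (c := c)

theorem test_diag_setQ (hT : Rep s (T.setQ c Q)) (hi : Param m s r i) :
    (vecAt (diagArr c) r).eval s ≠ 0 ↔ Q.diag i = 1 := by
  simpa using hT.test_diag hi (c := c)

theorem test_off_setQ (hT : Rep s (T.setQ c Q)) (hi : Param m s r i) (hj : Param m s r' j) :
    (matAt (offArr c) r r').eval s ≠ 0 ↔ Q.off.1 i j = 1 := by
  simpa using hT.test_off hi hj (c := c)

theorem reach_subst (hT : Rep s (T.setQ c Q)) (hi : Param 7 s r i) (hj : Param 7 s r' j) :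
    Reach (substProg c r r') s 7 (103 * size n) (T.setQ c (Q.subst i j)) := by
  have h := (Reach.whenQ (test_lin_setQ hT hi) (by norm_num) hT fun _ =>
    reach_toggle_lin hT hj).seq fun s₁ f₁ r₁ =>
    (Reach.whenQ (test_off_setQ r₁ (hi.frame f₁) (hj.frame f₁)) (by norm_num) r₁ fun _ =>
      reach_toggle_lin r₁ (hj.frame f₁)).seq fun s₂ f₂ r₂ =>
    (reach_forLoop_setQ (f := fun l Q => if Q.off.1 i l = 1 then Q.cz j l else Q) (by norm_num) r₂
      fun l s' T' Q' f' hl r' =>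
        have hi' := ((hi.frame (f₁.trans f₂)).frame f').mono (by norm_num : 7 ≤ 8)
        have hj' := ((hj.frame (f₁.trans f₂)).frame f').mono (by norm_num : 7 ≤ 8)
        Reach.whenQ (test_off_setQ r' hi' hl) (by norm_num) r' fun _ => reach_cz r' hj' hl).seq
    fun s₃ f₃ r₃ =>
      have hi₃ := (hi.frame (f₁.trans f₂)).frame f₃
      have hj₃ := (hj.frame (f₁.trans f₂)).frame f₃
      Reach.whenQ (test_diag_setQ r₃ hi₃) (by norm_num) r₃ fun _ =>
        (reach_p r₃ hj₃).seq fun s₄ f₄ r₄ => reach_cz r₄ (hi₃.frame f₄) (hj₃.frame f₄)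
  refine h.mono le_rfl ?_
  simp only [vecAt, matAt, Expr.cost]
  have := le_size n
  have := one_le_size n
  omega

/-- The program for `Tableau.rowAdd`. -/
def rowAddProg (r r' : ℕ) : Prog := forLoop 7 (.ite (matAt 8 r' 7) (toggleMat 8 r 7) .skip)

theorem reach_rowAdd (hT : Rep s T) (hi : Param 7 s r i) (hj : Param 7 s r' j) :
    Reach (rowAddProg r r') s 7 (25 * size n) (T.rowAdd i j) := by
  have h := reach_forLoop (f := fun l T => if T.A j l = 1 then T.toggleA i l else T) (r := 7)
    (by norm_num) hT
    fun l s' T' f' hl r' =>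
      have hi' := (hi.frame f').mono (by norm_num : 7 ≤ 8)
      have hj' := (hj.frame f').mono (by norm_num : 7 ≤ 8)
      Reach.when (r'.test_A hj' hl) (by norm_num) r' fun _ => reach_toggleA r' hi' hl
  refine h.mono le_rfl ?_
  simp only [matAt, Expr.cost]
  have := le_size n
  have := one_le_size n
  omega

/-- The program for `Tableau.cnotz`. -/
def cnotzProg (r r' : ℕ) : Prog := .seq (substProg true r r') (rowAddProg r r')

theorem reach_cnotz (hT : Rep s T) (hi : Param 7 s r i) (hj : Param 7 s r' j) :
    Reach (cnotzProg r r') s 7 (128 * size n) (T.cnotz i j) :=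
  ((Reach.mapQ (fun _ hQ => reach_subst hQ hi hj) hT).seq fun _ f₁ r₁ =>
    reach_rowAdd r₁ (hi.frame f₁) (hj.frame f₁)).mono le_rfl (by omega)

/-- The program for `Tableau.cnoty`. -/
def cnotyProg (r r' : ℕ) : Prog := .seq (substProg false r r') (cnotzProg r' r)

theorem reach_cnoty (hT : Rep s T) (hi : Param 7 s r i) (hj : Param 7 s r' j) :
    Reach (cnotyProg r r') s 7 (231 * size n) (T.cnoty i j) :=
  ((Reach.mapQ (fun _ hQ => reach_subst hQ hi hj) hT).seq fun _ f₁ r₁ =>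
    reach_cnotz r₁ (hj.frame f₁) (hi.frame f₁)).mono le_rfl (by omega)

theorem test_lt (hi : Param m s r i) (hj : Param m s r' j) :
    (Expr.lt (.reg r) (.reg r')).eval s ≠ 0 ↔ i < j := by
  simp [Expr.eval, hi.eq, hj.eq]

/-- The program for `QForm.complement`. -/
def complementProg (c : Bool) (r : ℕ) : Prog :=
  forLoop 6 <| .ite (matAt (offArr c) r 6)
    (.seq (pProg c 6) <| forLoop 7 <| .ite (.lt (.reg 7) (.reg 6))
      (.ite (matAt (offArr c) r 7) (czProg c 6 7) .skip) .skip) .skip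

theorem reach_complement (hT : Rep s (T.setQ c Q)) (hi : Param 6 s r i) :
    Reach (complementProg c r) s 6 (77 * size n ^ 2) (T.setQ c (Q.complement i)) := by
  have h := reach_forLoop_setQ (r := 6) (f := fun k Q => if Q.off.1 i k = 1 then
    forAll (fun l Q => if l < k then if Q.off.1 i l = 1 then Q.cz k l else Q else Q) (Q.p k)
    else Q) (t := 4 + (20 + (n * (24 + 7) + 6))) (by norm_num) hT
    fun k s' T' Q' f' hk r' =>
      have hi' := (hi.frame f').mono (by norm_num : 6 ≤ 7)
      Reach.whenQ (test_off_setQ r' hi' hk) (by omega) r' fun _ =>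
        (reach_p r' hk).seq fun s₁ f₁ r₁ =>
        reach_forLoop_setQ (r := 7) (by norm_num) r₁ fun l s₂ T₂ Q₂ f₂ hl r₂ =>
          have hi₂ := ((hi'.frame f₁).frame f₂).mono (by norm_num : 7 ≤ 8)
          have hk₂ := ((hk.frame f₁).frame f₂).mono (by norm_num : 7 ≤ 8)
          Reach.whenQ (test_lt hl hk₂) (by norm_num) r₂ fun _ =>
            Reach.whenQ (test_off_setQ r₂ hi₂ hl) (by norm_num) r₂ fun _ => reach_cz r₂ hk₂ hl
  refine h.mono le_rfl ?_
  have h1 := le_size n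
  have h2 := one_le_size n
  have h3 := size_le_sq n
  have h4 := mul_size_le_sq n
  have h5 : n * n ≤ size n ^ 2 := (Nat.mul_le_mul_left n h1).trans h4
  nlinarith

/-- The program for `Tableau.rowPhase`. -/
def rowPhaseProg (r : ℕ) : Prog :=
  .seq (.seq (complementProg false r) <|
    forLoop 6 (.ite (matAt (offArr false) r 6) (cnotzProg 6 r) .skip)) <|
  pProg true r

theorem reach_rowPhase (hT : Rep s T) (hi : Param 6 s r i) :
    Reach (rowPhaseProg r) s 6 (242 * size n ^ 2) (T.rowPhase i) := by
  have h := ((Reach.mapQ (c := false) (fun _ hQ => reach_complement hQ hi) hT).seq fun s₁ f₁ r₁ =>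
    reach_forLoop (f := fun k T => if (T.q false).off.1 i k = 1 then T.cnotz k i else T)
      (by norm_num) r₁ fun k s₂ T₂ f₂ hk r₂ =>
        have hi₂ := ((hi.frame f₁).frame f₂).mono (by norm_num : 6 ≤ 7)
        Reach.when (r₂.test_off hi₂ hk) (by have := one_le_size n; omega) r₂ fun _ =>
          reach_cnotz r₂ hk hi₂).seq fun s₃ f₃ r₃ =>
    Reach.mapQ (c := true) (fun _ hQ => reach_p hQ (hi.frame f₃)) r₃
  refine h.mono le_rfl ?_
  simp only [matAt, Expr.cost]
  have h1 := le_size n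
  have h2 := one_le_size n
  have h3 := size_le_sq n
  have h4 := mul_size_le_sq n
  nlinarith

/-- The program for `Tableau.argPhase`. -/
def argPhaseProg (r : ℕ) : Prog :=
  .ite (vecAt (linArr false) r)
    (.seq (.seq (.seq (rowPhaseProg r) (rowPhaseProg r)) (rowPhaseProg r)) (phaseProg 2))
    (rowPhaseProg r)

theorem reach_argPhase (hT : Rep s T) (hi : Param 6 s r i) :
    Reach (argPhaseProg r) s 6 (737 * size n ^ 2) (T.argPhase i) := by
  have h2 := one_le_size n
  have h3 := size_le_sq n
  have h := Reach.ite (hT.test_lin hi (c := false))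
    (fun _ => (((reach_rowPhase hT hi).seq fun s₁ f₁ r₁ =>
      reach_rowPhase r₁ (hi.frame f₁)).seq fun s₂ f₂ r₂ =>
      reach_rowPhase r₂ (hi.frame f₂)).seq fun s₃ f₃ r₃ => reach_phase r₃ 2)
    (fun _ => (reach_rowPhase hT hi).mono le_rfl (by omega))
  refine h.mono le_rfl ?_
  simp only [vecAt, Expr.cost]
  omega

/-- The program for `Tableau.flip`. -/
def flipProg (r : ℕ) : Prog :=
  .seq (.seq (.seq (.seq (.seq (argPhaseProg r) (argPhaseProg r)) (argPhaseProg r)) (phaseProg 1))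
    (toggleVec (linArr false) r)) (toggleVec 1 r)

theorem reach_flip (hT : Rep s T) (hi : Param 6 s r i) :
    Reach (flipProg r) s 6 (2231 * size n ^ 2) (T.flip i) := by
  have h2 := one_le_size n
  have h3 := size_le_sq n
  have h := (((((reach_argPhase hT hi).seq fun s₁ f₁ r₁ =>
    reach_argPhase r₁ (hi.frame f₁)).seq fun s₂ f₂ r₂ =>
    reach_argPhase r₂ (hi.frame f₂)).seq fun s₃ f₃ r₃ =>
    reach_phase r₃ 1).seq fun s₄ f₄ r₄ =>
    Reach.mapQ (c := false) (fun _ hQ => reach_toggle_lin hQ (hi.frame f₄)) r₄).seq fun s₅ f₅ r₅ =>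
    reach_toggleW r₅ (hi.frame f₅)
  exact h.mono le_rfl (by omega)

/-! ### The programs for the gates -/

/-- The program for `Tableau.gateP`. -/
def gatePProg (r : ℕ) : Prog :=
  .ite (vecAt 1 r)
    (.ite (vecAt (diagArr false) r) (.seq (flipProg r) (pProg false r)) (argPhaseProg r))
    (pProg false r)

theorem reach_gateP (hT : Rep s T) (hi : Param 6 s r i) :
    Reach (gatePProg r) s 6 (2259 * size n ^ 2) (T.gateP i) := by
  have h2 := one_le_size n
  have h3 := size_le_sq n
  have h := Reach.ite (hT.test_w hi)
    (fun _ => Reach.ite (hT.test_diag hi (c := false))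
      (fun _ => (reach_flip hT hi).seq fun s₁ f₁ r₁ =>
        Reach.mapQ (c := false) (fun _ hQ => reach_p hQ (hi.frame f₁)) r₁)
      (fun _ => (reach_argPhase hT hi).mono le_rfl (by omega)))
    (fun _ => (Reach.mapQ (c := false) (fun _ hQ => reach_p hQ hi) hT).mono le_rfl (by omega))
  refine h.mono le_rfl ?_
  simp only [vecAt, Expr.cost]
  omega

/-- The program for `Tableau.gateCXHard`. -/
def gateCXHardProg (r r' : ℕ) : Prog :=
  .ite (vecAt (diagArr false) r') (.seq (flipProg r') (cnotyProg r r')) <|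
  .ite (vecAt (diagArr false) r) (.seq (flipProg r) (cnotyProg r' r)) <|
  .ite (matAt (offArr false) r r')
    (.seq (.seq (.seq (.seq (.seq (argPhaseProg r') (flipProg r)) (cnotyProg r' r))
      (gatePProg r')) (gatePProg r')) (gatePProg r'))
    (.seq (.seq (.seq (.seq (.seq (.seq (.seq (.seq (toggleVec 1 r) (cnotyProg r' r))
      (argPhaseProg r)) (argPhaseProg r)) (argPhaseProg r)) (cnotyProg r' r)) (argPhaseProg r))
      (argPhaseProg r')) (toggleVec 1 r))

theorem reach_gateCXHard (hT : Rep s T) (hi : Param 6 s r i) (hj : Param 6 s r' j) :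
    Reach (gateCXHardProg r r') s 6 (10010 * size n ^ 2) (T.gateCXHard i j) := by
  have h2 := one_le_size n
  have h3 := size_le_sq n
  have hC : ∀ {s : State} {r r' : ℕ} {i j : Fin n} {T : Tableau n}, Rep s T → Param 6 s r i →
      Param 6 s r' j → Reach (cnotyProg r r') s 6 (231 * size n ^ 2) (T.cnoty i j) :=
    fun hT hi hj => (reach_cnoty hT (hi.mono (by norm_num)) (hj.mono (by norm_num))).mono
      (by norm_num) (by omega)
  have h := Reach.ite (t := 10000 * size n ^ 2) (hT.test_diag hj (c := false))
    (fun _ => ((reach_flip hT hj).seq fun s₁ f₁ r₁ =>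
      hC r₁ (hi.frame f₁) (hj.frame f₁)).mono le_rfl (by omega))
    (fun _ => (Reach.ite (t := 9990 * size n ^ 2) (hT.test_diag hi (c := false))
      (fun _ => ((reach_flip hT hi).seq fun s₁ f₁ r₁ =>
        hC r₁ (hj.frame f₁) (hi.frame f₁)).mono le_rfl (by omega))
      (fun _ => (Reach.ite (t := 9980 * size n ^ 2) (hT.test_off hi hj (c := false))
        (fun _ => ((((((reach_argPhase hT hj).seq fun s₁ f₁ r₁ =>
          reach_flip r₁ (hi.frame f₁)).seq fun s₁ f₁ r₁ =>
          hC r₁ (hj.frame f₁) (hi.frame f₁)).seq fun s₁ f₁ r₁ =>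
          reach_gateP r₁ (hj.frame f₁)).seq fun s₁ f₁ r₁ =>
          reach_gateP r₁ (hj.frame f₁)).seq fun s₁ f₁ r₁ =>
          reach_gateP r₁ (hj.frame f₁)).mono le_rfl (by omega))
        (fun _ => (((((((((reach_toggleW hT hi).seq fun s₁ f₁ r₁ =>
          hC r₁ (hj.frame f₁) (hi.frame f₁)).seq fun s₁ f₁ r₁ =>
          reach_argPhase r₁ (hi.frame f₁)).seq fun s₁ f₁ r₁ =>
          reach_argPhase r₁ (hi.frame f₁)).seq fun s₁ f₁ r₁ =>
          reach_argPhase r₁ (hi.frame f₁)).seq fun s₁ f₁ r₁ =>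
          hC r₁ (hj.frame f₁) (hi.frame f₁)).seq fun s₁ f₁ r₁ =>
          reach_argPhase r₁ (hi.frame f₁)).seq fun s₁ f₁ r₁ =>
          reach_argPhase r₁ (hj.frame f₁)).seq fun s₁ f₁ r₁ =>
          reach_toggleW r₁ (hi.frame f₁)).mono le_rfl (by omega))).mono le_rfl
          (by simp only [matAt, Expr.cost]; omega))).mono le_rfl
          (by simp only [vecAt, Expr.cost]; omega))
  refine h.mono le_rfl ?_
  simp only [vecAt, Expr.cost]
  omega

/-- The program for `Tableau.gateCX`. -/
def gateCXProg (r r' : ℕ) : Prog :=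
  .ite (vecAt 1 r)
    (.ite (vecAt 1 r') (cnotyProg r' r) (czProg false r r'))
    (.ite (vecAt 1 r') (gateCXHardProg r r') (cnotyProg r r'))

theorem reach_gateCX (hT : Rep s T) (hi : Param 6 s r i) (hj : Param 6 s r' j) :
    Reach (gateCXProg r r') s 6 (10020 * size n ^ 2) (T.gateCX i j) := by
  have h2 := one_le_size n
  have h3 := size_le_sq n
  have hC : ∀ {r r' : ℕ} {i j : Fin n}, Param 6 s r i →
      Param 6 s r' j → Reach (cnotyProg r r') s 6 (10010 * size n ^ 2) (T.cnoty i j) :=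
    fun hi hj => (reach_cnoty hT (hi.mono (by norm_num)) (hj.mono (by norm_num))).mono
      (by norm_num) (by omega)
  have h := Reach.ite (hT.test_w hi)
    (fun _ => Reach.ite (hT.test_w hj) (fun _ => hC hj hi)
      (fun _ =>
        (Reach.mapQ (c := false) (fun _ hQ => reach_cz hQ hi hj) hT).mono le_rfl (by omega)))
    (fun _ => Reach.ite (hT.test_w hj) (fun _ => reach_gateCXHard hT hi hj) (fun _ => hC hi hj))
  refine h.mono le_rfl ?_
  simp only [vecAt, Expr.cost]
  omega

/-- Multiplication by the gate whose code is in the row of the input given by register `3`. -/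
def gateProg : Prog :=
  .seq (.assign 4 (.cell 0 (.reg 3) (.const 1))) <|
  .seq (.assign 5 (.cell 0 (.reg 3) (.const 2))) <|
  .ite (.eq (.cell 0 (.reg 3) (.const 0)) (.const 0)) (gatePProg 4) <|
  .ite (.eq (.cell 0 (.reg 3) (.const 0)) (.const 1)) (toggleVec 1 4) (gateCXProg 4 5)

theorem reach_gate (hT : Rep s T) (g : Gate n) (h0 : s.mem 0 (s.reg 3) 0 = g.code.1)
    (h1 : s.mem 0 (s.reg 3) 1 = g.code.2.1) (h2 : s.mem 0 (s.reg 3) 2 = g.code.2.2) :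
    Reach gateProg s 4 (10040 * size n ^ 2) (T.gate g) := by
  have l2 := one_le_size n
  have l3 := size_le_sq n
  set s' := (s.setReg 4 g.code.2.1).setReg 5 g.code.2.2 with hs'
  have e₁ : Exec (.assign 4 (.cell 0 (.reg 3) (.const 1))) s 4 (s.setReg 4 g.code.2.1) := by
    rw [← h1]; exact Exec.assign s 4 (.cell 0 (.reg 3) (.const 1))
  have e₂ : Exec (.assign 5 (.cell 0 (.reg 3) (.const 2))) (s.setReg 4 g.code.2.1) 4 s' := by
    rw [hs', ← h2]; exact Exec.assign (s.setReg 4 g.code.2.1) 5 (.cell 0 (.reg 3) (.const 2))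
  have f' : Frame 4 s s' := (Frame.setReg s le_rfl _).trans (Frame.setReg _ (by norm_num) _)
  have r' : Rep s' T := (hT.setReg (by norm_num) _).setReg (by norm_num) _
  have hk : (Expr.cell 0 (.reg 3) (.const 0)).eval s' = g.code.1 := h0
  have h4 : s'.reg 4 = g.code.2.1 := by simp [hs', State.setReg]
  have h5 : s'.reg 5 = g.code.2.2 := by simp [hs', State.setReg]
  have main : Reach (.ite (.eq (.cell 0 (.reg 3) (.const 0)) (.const 0)) (gatePProg 4) <|
      .ite (.eq (.cell 0 (.reg 3) (.const 0)) (.const 1)) (toggleVec 1 4) (gateCXProg 4 5))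
      s' 4 (10032 * size n ^ 2) (T.gate g) := by
    have hc0 : (Expr.eq (.cell 0 (.reg 3) (.const 0)) (.const 0)).eval s' ≠ 0 ↔ g.code.1 = 0 := by
      rw [Expr.eval, hk]
      by_cases h : g.code.1 = 0 <;> simp [Expr.eval, h]
    have hc1 : (Expr.eq (.cell 0 (.reg 3) (.const 0)) (.const 1)).eval s' ≠ 0 ↔ g.code.1 = 1 := by
      rw [Expr.eval, hk]
      by_cases h : g.code.1 = 1 <;> simp [Expr.eval, h]
    cases g with
    | P i =>
      obtain ⟨t, s₁, e, l, f, hr⟩ := reach_gateP r' (i := i) ⟨by norm_num, by norm_num, h4⟩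
      refine ⟨_, s₁, .ite_true (hc0.2 rfl) e, ?_, f.mono (by norm_num), hr⟩
      simp only [Expr.cost]; omega
    | H i =>
      obtain ⟨t, s₁, e, l, f, hr⟩ :=
        reach_toggleW r' (i := i) (m := 6) ⟨by norm_num, by norm_num, h4⟩
      refine ⟨_, s₁, .ite_false (not_not.1 fun h => absurd (hc0.1 h) (by simp [Gate.code]))
        (.ite_true (hc1.2 rfl) e), ?_, f.mono (by norm_num), hr⟩
      simp only [Expr.cost]; omega
    | CX i j hij =>
      obtain ⟨t, s₁, e, l, f, hr⟩ := reach_gateCX r' (i := i) (j := j)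
        ⟨by norm_num, by norm_num, h4⟩ ⟨by norm_num, by norm_num, h5⟩
      refine ⟨_, s₁, .ite_false (not_not.1 fun h => absurd (hc0.1 h) (by simp [Gate.code]))
        (.ite_false (not_not.1 fun h => absurd (hc1.1 h) (by simp [Gate.code])) e), ?_,
        f.mono (by norm_num), hr⟩
      simp only [Expr.cost]; omega
  obtain ⟨t, s₁, e, l, f, hr⟩ := main
  exact ⟨_, s₁, .seq e₁ (.seq e₂ e), by omega, f'.trans f, hr⟩

/-! ### The program for a circuit -/

/-- Write the tableau of the identity. -/
def initProg : Prog := forLoop 7 (.seq (toggleVec 1 7) (toggleMat 8 7 7))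

/-- All arrays but the input array are zero at the start. The zero matrix `A` is not invertible, but
a tableau does not require this. -/
theorem rep_zero (C : List (Gate n)) :
    Rep (inputState C) (⟨0, fun _ => ⟨0, 0, ⟨0, by simp, by simp⟩⟩, 0, 0⟩ : Tableau n) where
  size := rfl
  k := rfl
  w _ := rfl
  lin c _ := by cases c <;> rfl
  diag c _ := by cases c <;> rfl
  off c _ _ := by cases c <;> rfl
  A _ _ := rfl

theorem reach_init (C : List (Gate n)) :
    Reach initProg (inputState C) 7 (29 * size n) (Tableau.identity n) := by
  have h := reach_forLoop (r := 7) (f := fun i T => (T.toggleW i).toggleA i i) (by norm_num)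
    (rep_zero C) fun i s₁ T₁ _ hi r₁ =>
      (reach_toggleW r₁ hi).seq fun s₂ f₂ r₂ => reach_toggleA r₂ (hi.frame f₂) (hi.frame f₂)
  have h1 := forAll_induction (f := fun i T => (T.toggleW i).toggleA i i)
    (a := (⟨0, fun _ => ⟨0, 0, ⟨0, by simp, by simp⟩⟩, 0, 0⟩ : Tableau n))
    (fun m T => T = ⟨fun l => if (l : ℕ) < m then 1 else 0, (Tableau.identity n).q,
      Matrix.diagonal fun l => if (l : ℕ) < m then 1 else 0, 0⟩) ?_ ?_
  · have h2 : forAll (fun i T => (T.toggleW i).toggleA i i)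
        (⟨0, fun _ => ⟨0, 0, ⟨0, by simp, by simp⟩⟩, 0, 0⟩ : Tableau n) = Tableau.identity n := by
      rw [h1]; simp [Tableau.identity]
    rw [h2] at h
    refine h.mono le_rfl ?_
    have := le_size n
    have := one_le_size n
    omega
  · simp only [not_lt_zero, if_false, Matrix.diagonal_zero]; rfl
  · rintro i T rfl
    have key : (fun l : Fin n => if (l : ℕ) < i + 1 then (1 : ZMod 2) else 0)
        = (fun l : Fin n => if (l : ℕ) < i then (1 : ZMod 2) else 0)
          + (Pi.single i 1 : BitVec₂ n) := by
      ext l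
      rw [Pi.add_apply, Pi.single_apply, ite_lt_succ (fun _ => 1)]
    have key' : Matrix.diagonal
          ((fun l : Fin n => if (l : ℕ) < i then (1 : ZMod 2) else 0) + (Pi.single i 1 : BitVec₂ n))
        = (Matrix.diagonal fun l : Fin n => if (l : ℕ) < i then (1 : ZMod 2) else 0)
          + Matrix.single i i 1 := by
      rw [← Matrix.diagonal_single]
      exact (Matrix.diagonal_add _ _).symm
    rw [key, key']
    rfl

/-- The program: starting with the tableau of the identity, multiply by the gates, from the last to
the first. -/
def mainProg : Prog :=
  .seq initProg <| .seq (.assign 3 (.reg 1)) <|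
  .loop (.reg 3) (.seq (.assign 3 (.pred (.reg 3))) gateProg)

/-- When register `3` holds `m`, the gates from the `m`-th on have been processed. -/
theorem reach_loop (C : List (Gate n)) (m : ℕ) (hm : m ≤ C.length) :
    ∀ s : State, s.mem 0 = (inputState C).mem 0 → s.reg 3 = m →
      Rep s (Tableau.ofCircuit (C.drop m)) →
      ∃ t s', Exec (.loop (.reg 3) (.seq (.assign 3 (.pred (.reg 3))) gateProg)) s t s' ∧
        t ≤ m * (10050 * size n ^ 2) + 2 ∧ Rep s' (Tableau.ofCircuit C) := by
  have l2 := one_le_size n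
  have l3 := size_le_sq n
  induction m with
  | zero =>
    intro s _ h3 hr
    exact ⟨_, s, .loop_false h3, by simp [Expr.cost], by simpa using hr⟩
  | succ m ih =>
    intro s h0 h3 hr
    have hlt : m < C.length := hm
    have hs : (s.setReg 3 m).reg 3 = m := by simp [State.setReg]
    have e₁ : Exec (.assign 3 (.pred (.reg 3))) s 3 (s.setReg 3 m) := by
      have := Exec.assign s 3 (.pred (.reg 3))
      simpa [Expr.eval, Expr.cost, h3] using this
    have hin : ∀ c, (s.setReg 3 m).mem 0 ((s.setReg 3 m).reg 3) c
        = if c = 0 then C[m].code.1 else if c = 1 then C[m].code.2.1 else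
          if c = 2 then C[m].code.2.2 else 0 := by
      intro c
      rw [hs]
      change s.mem 0 m c = _
      rw [h0]
      simp [inputState, hlt]
    obtain ⟨t₂, s₂, e₂, b₂, f₂, r₂⟩ := reach_gate (hr.setReg (r := 3) (by norm_num) m) C[m]
      (by simp [hin]) (by simp [hin]) (by simp [hin])
    have hd : (Tableau.ofCircuit (C.drop (m + 1))).gate C[m] = Tableau.ofCircuit (C.drop m) := by
      rw [List.drop_eq_getElem_cons hlt]; rfl
    rw [hd] at r₂
    obtain ⟨t₃, s₃, e₃, b₃, r₃⟩ := ih (by omega) s₂ (f₂.input.trans h0)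
      ((f₂.reg 3 (by norm_num) (by norm_num)).trans hs) r₂
    refine ⟨_, s₃, .loop_true (by simp [Expr.eval, h3]) (.seq e₁ e₂) e₃, ?_, r₃⟩
    simp only [Expr.cost]
    rw [Nat.succ_mul]; omega

theorem exec_mainProg (C : List (Gate n)) :
    ∃ t s, Exec mainProg (inputState C) t s ∧
      t ≤ 11000 * (max C.length 1 * (max n 1) ^ 2) ∧ Rep s (Tableau.ofCircuit C) := by
  have l2 := one_le_size n
  have l3 := size_le_sq n
  obtain ⟨t₁, s₁, e₁, b₁, f₁, r₁⟩ := reach_init C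
  have hreg : s₁.reg 1 = C.length := f₁.reg 1 (by norm_num) (by norm_num)
  have e₂ : Exec (.assign 3 (.reg 1)) s₁ 2 (s₁.setReg 3 C.length) := by
    rw [← hreg]; exact Exec.assign s₁ 3 (.reg 1)
  obtain ⟨t₃, s₃, e₃, b₃, r₃⟩ := reach_loop C C.length le_rfl (s₁.setReg 3 C.length) f₁.input
    (by simp [State.setReg]) (by simpa [Tableau.ofCircuit] using r₁.setReg (by norm_num) C.length)
  refine ⟨_, s₃, .seq e₁ (.seq e₂ e₃), ?_, r₃⟩
  have h1 : C.length * size n ^ 2 ≤ max C.length 1 * size n ^ 2 :=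
    Nat.mul_le_mul_right _ (le_max_left _ _)
  have h2 : 1 * size n ^ 2 ≤ max C.length 1 * size n ^ 2 :=
    Nat.mul_le_mul_right _ (le_max_right _ _)
  change _ ≤ 11000 * (max C.length 1 * size n ^ 2)
  nlinarith

theorem Rep.holds {s : State} {T : Tableau n} (hT : Rep s T) (h : IsUnit T.A) :
    s.Holds (T.toNormalForm h) where
  k := congrArg Nat.cast hT.k
  w := hT.w
  b := hT.diag false
  u := hT.lin false
  v := hT.lin true
  d := hT.diag true
  B := hT.off false
  D := hT.off true
  A := hT.A

end Stab

theorem mainTheorem1 :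
    ∃ (prog : Stab.Prog) (K : ℕ), ∀ (n : ℕ) (C : List (Stab.Gate n)),
      ∃ (t : ℕ) (s : Stab.State) (N : Stab.NormalForm n),
        Stab.Exec prog (Stab.inputState C) t s ∧
        t ≤ K * (max C.length 1 * (max n 1) ^ 2) ∧
        s.Holds N ∧
        Stab.circuitOp C = N.op := by
  refine ⟨Stab.mainProg, 11000, fun n C => ?_⟩
  obtain ⟨t, s, hexec, ht, hrep⟩ := Stab.exec_mainProg C
  have hop := Stab.Tableau.op_ofCircuit C
  have hA := (Stab.Tableau.ofCircuit C).isUnit_A (hop ▸ Stab.isUnit_circuitOp C)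
  exact ⟨t, s, _, hexec, ht, hrep.holds hA, by rw [Stab.Tableau.op_toNormalForm, hop]⟩
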